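/- Let $P$ be a real rational, strictly proper (relative degree greater than zero), single-input single-output discrete-time plant. Let $\tau\ge 0$ be an integer, let $p_0,\dots,p_\tau\ge 0$ with $\sum_i p_i=1$, and let $\alpha_0,\dots,\alpha_\tau\in\mathbb R$. The datum $u(n)$ sent at time $n\ge 0$ over the channel arrives with a random delay $\tau_n$, where $\{\tau_n\}$ is i.i.d. with $\Pr\{\tau_n=i\}=p_i$, $0\le i\le\tau$. With a controller $K$ the networked system, at rest before time $0$, is $$y=P\,(v-u_d),\qquad u=K\,y,\qquad u_d(k)=\sum_{i=0}^{\tau}\alpha_i\,\delta(\tau_{k-i}-i)\,u(k-i).$$ Let $H(z)=\sum_{i=0}^\tau \alpha_ip_iz^{-i}$ be the mean channel and assume $H\neq 0$. Let $\omega(n+i,n)=\alpha_i[\delta(\tau_n-i)-p_i]$ for $0\le i\le\tau$ (and $\omega(k,n)=0$ for $k<n$ or $k>n+\tau$), let $d(k)=\sum_{i=0}^{\tau}\omega(k,k-i)u(k-i)=u_d(k)-(Hu)(k)$ be the output of the channel uncertainty, let $r(l)=\mathbb E\sum_k\omega(k,n)\omega(k+l,n)$ and $S_\Omega(z)=\sum_{l=-\tau}^{\tau}r(l)z^{-l}$.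 Let $\Phi$ be a minimum phase spectral factor: a real polynomial in $z^{-1}$ of degree at most $\tau$ with $S_\Omega(z)=\Phi(z^{-1})\Phi(z)$ which, unless $\Phi=0$, has no zeros in $|z|>1$. Put $W=\Phi/H$ and $G=PK(1+PKH)^{-1}$. Let $\mathbb{RH}_\infty$ be the set of proper real rational functions all of whose poles lie in $|z|<1$. For $F\in\mathbb{RH}_\infty$ put $\|F\|_2^2=\frac1{2\pi}\int_{-\pi}^{\pi}|F(e^{j\theta})|^2d\theta$, and put $\|F\|_2=\infty$ for a real rational $F\notin\mathbb{RH}_\infty$. Let $PH=NM^{-1}=\tilde M^{-1}\tilde N$ be a doubly coprime factorization: $N,M,\tilde N,\tilde M,U,V,\tilde U,\tilde V\in\mathbb{RH}_\infty$, $M,\tilde M\ne0$, and $$\begin{bmatrix}\tilde V&\tilde U\\-\tilde N&\tilde M\end{bmatrix}\begin{bmatrix}M&-U\\N&V\end{bmatrix}=\begin{bmatrix}M&-U\\N&V\end{bmatrix}\begin{bmatrix}\tilde V&\tilde U\\-\tilde N&\tilde M\end{bmatrix}=I .$$ The system is called mean-square stabilizable via output feedback if there is a proper real rational controller $K$ such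 that 1. $K$ internally stabilizes the negative feedback loop with plant $PH$, that is, $1+PHK\neq0$ and $\frac{1}{1+PHK},\ \frac{K}{1+PHK},\ \frac{PH}{1+PHK},\ \frac{PHK}{1+PHK}\in\mathbb{RH}_\infty$; 2. the closed loop is mean-square input-output stable: all poles of $G$ lie in $|z|<1$, and for every white noise input $\{v(k)\}$ (zero mean, uncorrelated in time, with variances bounded uniformly in $k$) that is independent of $\{\tau_n\}$, both $\mathbb E\{u^2(k)\}$ and $\mathbb E\{d^2(k)\}$ are bounded uniformly in $k$. Then the networked system is mean-square stabilizable via output feedback if and only if $$\inf_{Q\in\mathbb{RH}_\infty}\big\|(U+MQ)\tilde N\,W\big\|_2^2<1 .$$ -/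

import Mathlib

open MeasureTheory ProbabilityTheory
open scoped ENNReal

noncomputable section

namespace DelayNCS

/-! ### Real rational transfer functions in the variable `z` -/

/-- Proper: the degree of the numerator is at most that of the denominator. -/
def IsProper (F : RatFunc ℝ) : Prop := F.num.degree ≤ F.denom.degree

/-- Strictly proper: the relative degree is positive (the zero function is included). -/
def IsStrictlyProper (F : RatFunc ℝ) : Prop := F.num.degree < F.denom.degree

/-- Stable: all poles lie in the open unit disc. (`F.num` and `F.denom` are coprime.) -/
def IsStable (F : RatFunc ℝ) : Prop :=
  ∀ z : ℂ, 1 ≤ ‖z‖ → Polynomial.aeval z F.denom ≠ 0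

/-- The set of all proper stable real rational transfer functions. -/
def RHinf : Set (RatFunc ℝ) := {F | IsProper F ∧ IsStable F}

open scoped Classical in
/-- The squared `H₂` norm. It is `(2π)⁻¹ ∫ |F(e^{jθ})|² dθ` over one period if `F` is proper and
stable, and `∞` if the rational function `F` does not belong to the Hardy space `H₂`. -/
def h2NormSq (F : RatFunc ℝ) : ℝ≥0∞ :=
  if F ∈ RHinf then
    ENNReal.ofReal ((2 * Real.pi)⁻¹ * ∫ θ in (-Real.pi)..Real.pi,
      ‖F.eval (algebraMap ℝ ℂ) (Complex.exp (θ * Complex.I))‖ ^ 2)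
  else ⊤

/-- The impulse response of a proper transfer function: `f n` is the coefficient of `z⁻ⁿ` in the
expansion of `F` at infinity, i.e. the coefficient of `wⁿ` in the Laurent series of `F (1 / w)`. -/
def impulseResponse (F : RatFunc ℝ) (n : ℕ) : ℝ :=
  ((F.eval (algebraMap ℝ (RatFunc ℝ)) (RatFunc.X)⁻¹ : RatFunc ℝ) : LaurentSeries ℝ).coeff (n : ℤ)

/-- `K` internally stabilizes the negative feedback loop with loop plant `L`: the loop is
well posed and all four closed-loop transfer functions are proper and stable. -/
def InternallyStabilizes (K L : RatFunc ℝ) : Prop :=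
  1 + L * K ≠ 0 ∧ 1 / (1 + L * K) ∈ RHinf ∧ K / (1 + L * K) ∈ RHinf ∧
    L / (1 + L * K) ∈ RHinf ∧ L * K / (1 + L * K) ∈ RHinf

/-- A doubly coprime factorization `L = N M⁻¹ = Mt⁻¹ Nt` over the proper stable transfer
functions, with its Bezout factors. -/
structure IsDoublyCoprime (L N M Nt Mt U V Ut Vt : RatFunc ℝ) : Prop where
  N_mem : N ∈ RHinf
  M_mem : M ∈ RHinf
  Nt_mem : Nt ∈ RHinf
  Mt_mem : Mt ∈ RHinf
  U_mem : U ∈ RHinf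
  V_mem : V ∈ RHinf
  Ut_mem : Ut ∈ RHinf
  Vt_mem : Vt ∈ RHinf
  M_ne_zero : M ≠ 0
  Mt_ne_zero : Mt ≠ 0
  right_fac : L = N * M⁻¹
  left_fac : L = Mt⁻¹ * Nt
  bezout : !![Vt, Ut; -Nt, Mt] * !![M, -U; N, V] = 1
  bezout' : !![M, -U; N, V] * !![Vt, Ut; -Nt, Mt] = 1

/-! ### The channel with random transmission delays -/

/-- The data of the channel: the largest delay, the probability mass function of the delay,
and the weights of the received data. -/
structure Channel where
  maxDelay : ℕ
  prob : Fin (maxDelay + 1) → ℝ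
  prob_nonneg : ∀ i, 0 ≤ prob i
  prob_sum : ∑ i, prob i = 1
  weight : Fin (maxDelay + 1) → ℝ

namespace Channel

/-- `c.response j i` is the response `h (n + i, n)` of the channel at time `n + i` to a unit impulse
applied at time `n`, if the datum sent at time `n` has delay `j`. -/
def response (c : Channel) (j : Fin (c.maxDelay + 1)) (i : ℕ) : ℝ :=
  if (j : ℕ) = i then c.weight j else 0

/-- The expected impulse response. -/
def meanResponse (c : Channel) (i : ℕ) : ℝ := ∑ j, c.prob j * c.response j i

/-- The deviation `ω (n + i, n) = h (n + i, n) - E h (n + i, n)` if the datum sent at time `n` has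
delay `j`: the impulse response of the channel uncertainty. -/
def deviation (c : Channel) (j : Fin (c.maxDelay + 1)) (i : ℕ) : ℝ :=
  c.response j i - c.meanResponse i

/-- The mean channel `H(z) = ∑ αᵢ pᵢ z⁻ⁱ`. -/
def meanTF (c : Channel) : RatFunc ℝ :=
  ∑ i, RatFunc.C (c.weight i * c.prob i) * (RatFunc.X)⁻¹ ^ (i : ℕ)

/-- The autocorrelation `r(l) = E ∑ₖ ω(k, n) ω(k + l, n)`; the deviation vanishes outside
`n ≤ k ≤ n + maxDelay`. -/
def autocorr (c : Channel) (l : ℤ) : ℝ :=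
  ∑ j, c.prob j * ∑ a ∈ Finset.range (c.maxDelay + 1), ∑ b ∈ Finset.range (c.maxDelay + 1),
    if (b : ℤ) = (a : ℤ) + l then c.deviation j a * c.deviation j b else 0

/-- The energy spectral density `∑ₗ r(l) z⁻ˡ` of the channel uncertainty. -/
def spectralDensity (c : Channel) : RatFunc ℝ :=
  ∑ l ∈ Finset.Icc (-(c.maxDelay : ℤ)) (c.maxDelay : ℤ),
    RatFunc.C (c.autocorr l) * (RatFunc.X : RatFunc ℝ) ^ (-l)

/-- `Φ` is a minimum phase spectral factor: `Φ(z) = φ(z⁻¹)` for a real polynomial `φ` of degree at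
most `maxDelay`, all zeros of `Φ` lie in the closed unit disc (unless `Φ = 0`), and
`S(z) = Φ(z⁻¹) Φ(z)`. -/
def IsSpectralFactor (c : Channel) (Φ : RatFunc ℝ) : Prop :=
  ∃ φ : Polynomial ℝ, φ.natDegree ≤ c.maxDelay ∧
    Φ = Polynomial.aeval (RatFunc.X : RatFunc ℝ)⁻¹ φ ∧
    (φ ≠ 0 → ∀ z : ℂ, 1 < ‖z‖ → Polynomial.aeval z⁻¹ φ ≠ 0) ∧
    c.spectralDensity = Polynomial.aeval (RatFunc.X : RatFunc ℝ) φ * Φ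

end Channel

/-! ### The random signals -/

/-- The delays are i.i.d. with the probability mass function of the channel. -/
structure IsDelayProcess (c : Channel) {Ω : Type} [MeasurableSpace Ω] (μ : Measure Ω)
    (τ : ℕ → Ω → Fin (c.maxDelay + 1)) : Prop where
  measurable : ∀ n, Measurable (τ n)
  indep : iIndepFun τ μ
  law : ∀ n i, μ {ω | τ n ω = i} = ENNReal.ofReal (c.prob i)

/-- White noise with zero mean and bounded, possibly time-varying, variances. -/
structure IsWhiteNoise {Ω : Type} [MeasurableSpace Ω] (μ : Measure Ω) (v : ℕ → Ω → ℝ) : Prop where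
  measurable : ∀ k, Measurable (v k)
  memLp : ∀ k, MemLp (v k) 2 μ
  mean_zero : ∀ k, ∫ ω, v k ω ∂μ = 0
  uncorrelated : ∀ j k, j ≠ k → ∫ ω, v j ω * v k ω ∂μ = 0
  bounded_variance : ∃ C : ℝ, ∀ k, ∫ ω, v k ω ^ 2 ∂μ ≤ C

/-- The signals of the networked feedback loop, at rest before time `0`, along one path of the
delays `τ`: the plant output `y`, the control signal `u`, the received control signal `ud`, and
the output `d` of the channel uncertainty. -/
structure IsLoopResponse (c : Channel) (P K : RatFunc ℝ) (τ : ℕ → Fin (c.maxDelay + 1))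
    (v y u ud d : ℕ → ℝ) : Prop where
  plant : ∀ k, y k = ∑ q ∈ Finset.HasAntidiagonal.antidiagonal k,
    impulseResponse P q.1 * (v q.2 - ud q.2)
  controller : ∀ k, u k = ∑ q ∈ Finset.HasAntidiagonal.antidiagonal k,
    impulseResponse K q.1 * y q.2
  channel : ∀ k, ud k = ∑ q ∈ Finset.HasAntidiagonal.antidiagonal k,
    c.response (τ q.2) q.1 * u q.2
  uncertainty : ∀ k, d k = ∑ q ∈ Finset.HasAntidiagonal.antidiagonal k,
    c.deviation (τ q.2) q.1 * u q.2

/-! ### Mean-square stability and stabilizability -/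

/-- The nominal closed-loop system `G = P K (1 + P K H)⁻¹`. -/
def nominal (c : Channel) (P K : RatFunc ℝ) : RatFunc ℝ :=
  P * K * (1 + P * K * c.meanTF)⁻¹

/-- Mean-square input-output stability: the nominal system is stable and, for every white noise
input that is independent of the delays, the second moments of `u` and `d` are bounded. -/
def IsMeanSquareIOStable (c : Channel) (P K : RatFunc ℝ) : Prop :=
  IsStable (nominal c P K) ∧
  ∀ (Ω : Type) [MeasurableSpace Ω] (μ : Measure Ω) [IsProbabilityMeasure μ]
    (τ : ℕ → Ω → Fin (c.maxDelay + 1)) (v y u ud d : ℕ → Ω → ℝ),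
    IsDelayProcess c μ τ → IsWhiteNoise μ v →
    IndepFun (fun ω n => τ n ω) (fun ω k => v k ω) μ →
    (∀ ω, IsLoopResponse c P K (fun n => τ n ω) (fun k => v k ω) (fun k => y k ω)
      (fun k => u k ω) (fun k => ud k ω) (fun k => d k ω)) →
    ∃ C : NNReal, ∀ k, ∫⁻ ω, ENNReal.ofReal (u k ω ^ 2) ∂μ ≤ C ∧
      ∫⁻ ω, ENNReal.ofReal (d k ω ^ 2) ∂μ ≤ C

/-- Mean-square stabilizability via output feedback, by a proper controller that internally
stabilizes the nominal feedback loop. -/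
def IsMeanSquareStabilizable (c : Channel) (P : RatFunc ℝ) : Prop :=
  ∃ K : RatFunc ℝ, IsProper K ∧ InternallyStabilizes K (P * c.meanTF) ∧
    IsMeanSquareIOStable c P K

end DelayNCS

end

/-! Write `G = PK(1 + PKH)⁻¹`, `g` for its impulse response and `ω_j` for the deviation of the
channel response when the delay is `j`. Eliminating `y` and `ud` gives `u = G(v - d)`, and `d` is
the sum of the deviations of the data sent so far. Since `P` is strictly proper, `G` starts with a
delay of one step. Hence `u(n)` depends only on the input and on the delays of data sent before `n`,
and is independent of `τ_n`. As the `ω_j` average to zero, the contributions of different data to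
`u(k)` are orthogonal to each other and to that of `v`. This is the renewal equation of
`second_moment_control`: `E u(k)² = ∑ g(k-n)² E v(n)² + ∑_{n<k} σ(k-n) E u(n)²`, where `σ(l)` is the
mean square of the coefficient of `G ω_j` at lag `l`.

If `∑ σ < 1`, the solution stays bounded (`bounded_of_renewal`). If `G ≠ 0` and `v` has unit
variance, it can stay bounded only if `∑ σ < 1` (`lt_one_of_renewal`). By Parseval and the spectral
factorization, `∑ σ = ‖GΦ‖₂²` (`IsSpectralFactor.exists_hasSum_gain`).

The Youla parametrization matches stabilizing controllers of `PH` with parameters `Q` so that `(U +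
MQ)Nt = GH`, hence `(U + MQ)Nt W = GΦ`. A strict bound on the infimum is the same bound for a single
`Q`, so attainment plays no role.

One gap remains: internal stability controls `GH`, not `G`, because `H` may have zeros in `|z| ≥ 1`.
Finiteness of the norm adds that `GΦ` is stable, and `H` and `Φ` have no common zero there
(`IsSpectralFactor.evalAt_ne_zero`), so `G` is stable. -/

namespace DelayNCS

/-! ### The ring of proper stable rational functions -/

open scoped Classical in
/-- The valuation of `RatFunc ℝ` at infinity. -/
noncomputable def inftyVal : Valuation (RatFunc ℝ) (WithZero (Multiplicative ℤ)) :=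
  RatFunc.inftyValuation ℝ

open scoped Classical in
lemma inftyVal_of_ne_zero {F : RatFunc ℝ} (hF : F ≠ 0) : inftyVal F = WithZero.exp F.intDegree := by
  exact RatFunc.inftyValuation_of_nonzero ℝ hF

/-- In valuation form, closure under sums and products and the invertibility at infinity of `1 + F`
for strictly proper `F` follow from the ultrametric axioms. -/
lemma isProper_iff_inftyVal_le_one {F : RatFunc ℝ} : IsProper F ↔ inftyVal F ≤ 1 := by
  by_cases hF : F = 0
  · subst hF; simp [IsProper]
  rw [inftyVal_of_ne_zero hF, IsProper, Polynomial.degree_eq_natDegree (RatFunc.num_ne_zero hF),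
    Polynomial.degree_eq_natDegree F.denom_ne_zero, RatFunc.intDegree, ← WithZero.exp_zero,
    WithZero.exp_le_exp]
  simp

lemma isStrictlyProper_iff_inftyVal_lt_one {F : RatFunc ℝ} :
    IsStrictlyProper F ↔ inftyVal F < 1 := by
  by_cases hF : F = 0
  · subst hF; simp [IsStrictlyProper]
  rw [inftyVal_of_ne_zero hF, IsStrictlyProper,
    Polynomial.degree_eq_natDegree (RatFunc.num_ne_zero hF),
    Polynomial.degree_eq_natDegree F.denom_ne_zero, RatFunc.intDegree, ← WithZero.exp_zero,
    WithZero.exp_lt_exp]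
  simp

lemma inftyVal_X_inv : inftyVal (RatFunc.X)⁻¹ < 1 := by
  rw [inftyVal_of_ne_zero (inv_ne_zero RatFunc.X_ne_zero), RatFunc.intDegree_inv,
    RatFunc.intDegree_X, ← WithZero.exp_zero, WithZero.exp_lt_exp]
  norm_num

lemma inftyVal_C_le_one (r : ℝ) : inftyVal (RatFunc.C r) ≤ 1 := by
  rw [← isProper_iff_inftyVal_le_one, IsProper, RatFunc.num_C, RatFunc.denom_C]
  simpa using Polynomial.degree_C_le

/-- The value of a rational function at a complex number. -/
noncomputable abbrev evalAt (z : ℂ) (F : RatFunc ℝ) : ℂ := F.eval (algebraMap ℝ ℂ) z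

/-- The rational functions without a pole at `z`. -/
noncomputable def regularAt (z : ℂ) : Subalgebra ℝ (RatFunc ℝ) where
  carrier := {F | Polynomial.aeval z F.denom ≠ 0}
  mul_mem' {F G} hF hG h := by
    have := Polynomial.eval₂_eq_zero_of_dvd_of_eval₂_eq_zero (algebraMap ℝ ℂ) z
      (RatFunc.denom_mul_dvd F G) h
    rw [Polynomial.eval₂_mul] at this
    exact (mul_ne_zero hF hG) this
  add_mem' {F G} hF hG h := by
    have := Polynomial.eval₂_eq_zero_of_dvd_of_eval₂_eq_zero (algebraMap ℝ ℂ) z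
      (RatFunc.denom_add_dvd F G) h
    rw [Polynomial.eval₂_mul] at this
    exact (mul_ne_zero hF hG) this
  algebraMap_mem' r := by simp [RatFunc.algebraMap_eq_C]

lemma mem_regularAt {z : ℂ} {F : RatFunc ℝ} :
    F ∈ regularAt z ↔ Polynomial.aeval z F.denom ≠ 0 := Iff.rfl

/-- Evaluation at `z` as an algebra homomorphism. -/
noncomputable def evalHom (z : ℂ) : regularAt z →ₐ[ℝ] ℂ where
  toFun F := evalAt z F
  map_one' := by simp
  map_mul' F G := RatFunc.eval_mul _ _ F.2 G.2
  map_zero' := by simp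
  map_add' F G := RatFunc.eval_add _ _ F.2 G.2
  commutes' r := by
    have : ((algebraMap ℝ (regularAt z) r : regularAt z) : RatFunc ℝ) = RatFunc.C r := rfl
    rw [this, evalAt, RatFunc.eval_C]

lemma evalAt_add {z : ℂ} {F G : RatFunc ℝ} (hF : F ∈ regularAt z) (hG : G ∈ regularAt z) :
    evalAt z (F + G) = evalAt z F + evalAt z G := RatFunc.eval_add _ _ hF hG

lemma evalAt_mul {z : ℂ} {F G : RatFunc ℝ} (hF : F ∈ regularAt z) (hG : G ∈ regularAt z) :
    evalAt z (F * G) = evalAt z F * evalAt z G := RatFunc.eval_mul _ _ hF hG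

lemma evalAt_sum {ι : Type*} {z : ℂ} {F : ι → RatFunc ℝ} (s : Finset ι)
    (hF : ∀ i ∈ s, F i ∈ regularAt z) : evalAt z (∑ i ∈ s, F i) = ∑ i ∈ s, evalAt z (F i) := by
  classical
  induction s using Finset.induction_on with
  | empty => simp
  | insert a s ha ih =>
    rw [Finset.sum_insert ha, Finset.sum_insert ha, evalAt_add (hF a (by simp))
      (sum_mem fun i hi => hF i (by simp [hi])), ih fun i hi => hF i (by simp [hi])]

lemma inv_mem_regularAt {z : ℂ} {F : RatFunc ℝ} (hz : evalAt z F ≠ 0) :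
    F⁻¹ ∈ regularAt z := by
  intro h
  have hF : F ≠ 0 := by rintro rfl; simp at hz
  have := Polynomial.eval₂_eq_zero_of_dvd_of_eval₂_eq_zero (algebraMap ℝ ℂ) z
      (RatFunc.denom_inv_dvd hF) h
  apply hz
  rw [evalAt, RatFunc.eval, this, zero_div]

lemma C_mem_regularAt (z : ℂ) (r : ℝ) : RatFunc.C r ∈ regularAt z := (regularAt z).algebraMap_mem r

lemma X_mem_regularAt (z : ℂ) : RatFunc.X ∈ regularAt z := by simp [mem_regularAt]

lemma X_inv_mem_regularAt {z : ℂ} (hz : z ≠ 0) : (RatFunc.X)⁻¹ ∈ regularAt z :=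
  inv_mem_regularAt (by simpa using hz)

lemma evalAt_inv {z : ℂ} {F : RatFunc ℝ} (hF : F ∈ regularAt z) (hz : evalAt z F ≠ 0) :
    evalAt z F⁻¹ = (evalAt z F)⁻¹ := by
  apply eq_inv_of_mul_eq_one_left
  rw [← evalAt_mul (inv_mem_regularAt hz) hF, inv_mul_cancel₀, evalAt, RatFunc.eval_one]
  rintro rfl; simp at hz

lemma evalAt_X_inv {z : ℂ} (hz : z ≠ 0) : evalAt z (RatFunc.X)⁻¹ = z⁻¹ := by
  rw [evalAt_inv (X_mem_regularAt z) (by simpa using hz), evalAt, RatFunc.eval_X]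

lemma aeval_mem_regularAt {z : ℂ} {F : RatFunc ℝ} (hF : F ∈ regularAt z) (p : Polynomial ℝ) :
    Polynomial.aeval F p ∈ regularAt z := by
  have := Polynomial.aeval_algHom_apply (regularAt z).val ⟨F, hF⟩ p
  rw [Subalgebra.coe_val] at this
  rw [this]
  exact Subtype.property _

lemma evalAt_aeval {z : ℂ} {F : RatFunc ℝ} (hF : F ∈ regularAt z) (p : Polynomial ℝ) :
    evalAt z (Polynomial.aeval F p) = Polynomial.aeval (evalAt z F) p := by
  have h := Polynomial.aeval_algHom_apply (regularAt z).val ⟨F, hF⟩ p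
  have h' := Polynomial.aeval_algHom_apply (evalHom z) ⟨F, hF⟩ p
  rw [Subalgebra.coe_val] at h
  rw [h]
  exact h'.symm

/-- The proper stable rational functions as an algebra. -/
noncomputable def rhinf : Subalgebra ℝ (RatFunc ℝ) where
  carrier := RHinf
  mul_mem' {F G} hF hG := by
    refine ⟨?_, fun z hz => (regularAt z).mul_mem (hF.2 z hz) (hG.2 z hz)⟩
    have hF := isProper_iff_inftyVal_le_one.1 hF.1
    have hG := isProper_iff_inftyVal_le_one.1 hG.1
    rw [isProper_iff_inftyVal_le_one, map_mul]
    exact mul_le_one' hF hG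
  add_mem' {F G} hF hG := by
    refine ⟨?_, fun z hz => (regularAt z).add_mem (hF.2 z hz) (hG.2 z hz)⟩
    have hF := isProper_iff_inftyVal_le_one.1 hF.1
    have hG := isProper_iff_inftyVal_le_one.1 hG.1
    rw [isProper_iff_inftyVal_le_one]
    exact inftyVal.map_add_le hF hG
  algebraMap_mem' r :=
    ⟨isProper_iff_inftyVal_le_one.2 (inftyVal_C_le_one r),
      fun z _ => (regularAt z).algebraMap_mem r⟩

lemma mem_rhinf {F : RatFunc ℝ} : F ∈ rhinf ↔ F ∈ RHinf := Iff.rfl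

lemma C_mem_rhinf (r : ℝ) : RatFunc.C r ∈ rhinf := rhinf.algebraMap_mem r

lemma X_inv_mem_rhinf : (RatFunc.X)⁻¹ ∈ rhinf :=
  ⟨isProper_iff_inftyVal_le_one.2 inftyVal_X_inv.le, fun z hz =>
    X_inv_mem_regularAt (norm_pos_iff.1 (by linarith))⟩

lemma aeval_X_inv_mem_rhinf (p : Polynomial ℝ) :
    Polynomial.aeval (RatFunc.X : RatFunc ℝ)⁻¹ p ∈ rhinf := by
  have := Polynomial.aeval_algHom_apply rhinf.val ⟨_, X_inv_mem_rhinf⟩ p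
  rw [Subalgebra.coe_val] at this
  rw [this]
  exact Subtype.property _

lemma Channel.meanTF_mem_rhinf (c : Channel) : c.meanTF ∈ rhinf :=
  sum_mem fun _ _ => rhinf.mul_mem (C_mem_rhinf _) (rhinf.pow_mem X_inv_mem_rhinf _)

lemma mem_regularAt_of_mem_rhinf {F : RatFunc ℝ} (hF : F ∈ rhinf) {z : ℂ} (hz : 1 ≤ ‖z‖) :
    F ∈ regularAt z := hF.2 z hz

/-! ### Impulse responses as power series -/

section ImpulseSeries
open Polynomial LaurentSeries

/-- The rational function `F(1 / X)`. -/
noncomputable def recipTF (F : RatFunc ℝ) : RatFunc ℝ :=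
  F.eval (algebraMap ℝ (RatFunc ℝ)) (RatFunc.X)⁻¹

/-- `X⁻¹` is transcendental over `ℝ`. Thus no denominator vanishes there, which is what
`RatFunc.eval` needs in order to respect sums and products. -/
lemma eval₂_X_inv_ne_zero {p : ℝ[X]} (hp : p ≠ 0) :
    Polynomial.eval₂ (algebraMap ℝ (RatFunc ℝ)) (RatFunc.X)⁻¹ p ≠ 0 := by
  have h : Transcendental ℝ ((RatFunc.X : RatFunc ℝ)⁻¹) := by
    intro h
    exact RatFunc.transcendental_X (by simpa using h.inv)
  exact fun h0 => hp (transcendental_iff.1 h p h0)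

lemma recipTF_mul (F G : RatFunc ℝ) : recipTF (F * G) = recipTF F * recipTF G :=
  RatFunc.eval_mul _ _ (eval₂_X_inv_ne_zero F.denom_ne_zero) (eval₂_X_inv_ne_zero G.denom_ne_zero)

lemma recipTF_add (F G : RatFunc ℝ) : recipTF (F + G) = recipTF F + recipTF G :=
  RatFunc.eval_add _ _ (eval₂_X_inv_ne_zero F.denom_ne_zero) (eval₂_X_inv_ne_zero G.denom_ne_zero)

lemma eval₂_X_inv (p : ℝ[X]) {N : ℕ} (hN : p.natDegree ≤ N) :
    Polynomial.eval₂ (algebraMap ℝ (RatFunc ℝ)) (RatFunc.X)⁻¹ p =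
      algebraMap ℝ[X] (RatFunc ℝ) (p.reflect N) * (RatFunc.X)⁻¹ ^ N := by
  let : Invertible (RatFunc.X : RatFunc ℝ)⁻¹ := ⟨RatFunc.X,
    mul_inv_cancel₀ RatFunc.X_ne_zero, inv_mul_cancel₀ RatFunc.X_ne_zero⟩
  rw [← Polynomial.eval₂_reflect_mul_pow (algebraMap ℝ (RatFunc ℝ)) (RatFunc.X)⁻¹ N p hN,
    ← RatFunc.aeval_X_left_eq_algebraMap]
  rfl

lemma natDegree_num_le {F : RatFunc ℝ} (hF : IsProper F) : F.num.natDegree ≤ F.denom.natDegree :=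
  Polynomial.natDegree_le_natDegree hF

lemma recipTF_eq_div {F : RatFunc ℝ} (hF : IsProper F) :
    recipTF F = algebraMap ℝ[X] (RatFunc ℝ) (F.num.reflect F.denom.natDegree) /
      algebraMap ℝ[X] (RatFunc ℝ) F.denom.reverse := by
  rw [recipTF, RatFunc.eval, eval₂_X_inv _ (natDegree_num_le hF), eval₂_X_inv _ le_rfl,
    mul_div_mul_right _ _ (pow_ne_zero _ (inv_ne_zero RatFunc.X_ne_zero))]
  rfl

/-- The generating function of the impulse response. -/
noncomputable def impulseSeries (F : RatFunc ℝ) : PowerSeries ℝ := PowerSeries.mk (impulseResponse F)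

@[simp] lemma coeff_impulseSeries (F : RatFunc ℝ) (n : ℕ) :
    PowerSeries.coeff n (impulseSeries F) = impulseResponse F n := PowerSeries.coeff_mk _ _

lemma constantCoeff_reverse_denom_ne_zero (F : RatFunc ℝ) :
    PowerSeries.constantCoeff (F.denom.reverse : PowerSeries ℝ) ≠ 0 := by
  rw [← PowerSeries.coeff_zero_eq_constantCoeff_apply, Polynomial.coeff_coe,
    Polynomial.coeff_zero_reverse]
  simp [F.monic_denom.leadingCoeff]

lemma exists_powerSeries_eq_recipTF {F : RatFunc ℝ} (hF : IsProper F) :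
    ∃ f : PowerSeries ℝ, (recipTF F : ℝ⸨X⸩) = (f : ℝ⸨X⸩) ∧
      f * (F.denom.reverse : PowerSeries ℝ) =
        (F.num.reflect F.denom.natDegree : PowerSeries ℝ) := by
  have h0 := constantCoeff_reverse_denom_ne_zero F
  set q : PowerSeries ℝ := (F.denom.reverse : PowerSeries ℝ) with hq
  set p : PowerSeries ℝ := (F.num.reflect F.denom.natDegree : PowerSeries ℝ) with hp
  have hfq : p * q⁻¹ * q = p := by rw [mul_assoc, PowerSeries.inv_mul_cancel _ h0, mul_one]
  refine ⟨p * q⁻¹, ?_, hfq⟩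
  have hq0 : (q : ℝ⸨X⸩) ≠ 0 := by
    intro h
    rw [← PowerSeries.coe_zero] at h
    have := HahnSeries.ofPowerSeries_injective h
    rw [this] at h0
    simp at h0
  have e := RatFunc.coe_coe (F.num.reflect F.denom.natDegree)
  have e' := RatFunc.coe_coe F.denom.reverse
  rw [recipTF_eq_div hF, map_div₀, ← RatFunc.coePolynomial_eq_algebraMap,
    ← RatFunc.coePolynomial_eq_algebraMap, ← e, ← e', div_eq_iff hq0, ← PowerSeries.coe_mul,
    hfq]

lemma impulseSeries_eq_of_coe {F : RatFunc ℝ} {f : PowerSeries ℝ}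
    (h : (recipTF F : ℝ⸨X⸩) = (f : ℝ⸨X⸩)) : impulseSeries F = f := by
  ext n
  rw [coeff_impulseSeries, ← LaurentSeries.coeff_coe_powerSeries, ← h]
  rfl

lemma coe_impulseSeries {F : RatFunc ℝ} (hF : IsProper F) :
    (impulseSeries F : ℝ⸨X⸩) = (recipTF F : ℝ⸨X⸩) := by
  obtain ⟨f, hf, -⟩ := exists_powerSeries_eq_recipTF hF
  rw [impulseSeries_eq_of_coe hf, hf]

lemma impulseSeries_mul_reverse_denom {F : RatFunc ℝ} (hF : IsProper F) :
    impulseSeries F * (F.denom.reverse : PowerSeries ℝ) =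
      (F.num.reflect F.denom.natDegree : PowerSeries ℝ) := by
  obtain ⟨f, hf, h⟩ := exists_powerSeries_eq_recipTF hF
  rw [impulseSeries_eq_of_coe hf, h]

lemma impulseSeries_mul {F G : RatFunc ℝ} (hF : IsProper F) (hG : IsProper G) :
    impulseSeries (F * G) = impulseSeries F * impulseSeries G := by
  apply impulseSeries_eq_of_coe
  rw [recipTF_mul, PowerSeries.coe_mul, coe_impulseSeries hF, coe_impulseSeries hG, map_mul]

lemma impulseSeries_add {F G : RatFunc ℝ} (hF : IsProper F) (hG : IsProper G) :
    impulseSeries (F + G) = impulseSeries F + impulseSeries G := by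
  apply impulseSeries_eq_of_coe
  rw [recipTF_add, PowerSeries.coe_add, coe_impulseSeries hF, coe_impulseSeries hG, map_add]

lemma impulseSeries_C (r : ℝ) : impulseSeries (RatFunc.C r) = PowerSeries.C r := by
  apply impulseSeries_eq_of_coe
  rw [recipTF, RatFunc.eval_C, PowerSeries.coe_C, RatFunc.algebraMap_eq_C, ← RatFunc.algebraMap_C,
    ← RatFunc.coePolynomial_eq_algebraMap, ← RatFunc.coe_coe]
  simp

lemma impulseSeries_one : impulseSeries 1 = 1 := by
  have := impulseSeries_C 1
  simpa using this

lemma impulseSeries_X_inv : impulseSeries (RatFunc.X)⁻¹ = PowerSeries.X := by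
  apply impulseSeries_eq_of_coe
  have h : recipTF (RatFunc.X)⁻¹ = RatFunc.X := by
    have h1 : recipTF 1 = 1 := by simp [recipTF]
    have h2 : recipTF RatFunc.X = (RatFunc.X)⁻¹ := by simp [recipTF]
    have := recipTF_mul (RatFunc.X)⁻¹ RatFunc.X
    rw [inv_mul_cancel₀ RatFunc.X_ne_zero, h1, h2] at this
    exact (eq_of_mul_inv_eq_one this.symm)
  rw [h, RatFunc.coe_X, PowerSeries.coe_X]

lemma isProper_mul {F G : RatFunc ℝ} (hF : IsProper F) (hG : IsProper G) : IsProper (F * G) := by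
  rw [isProper_iff_inftyVal_le_one] at *
  rw [map_mul]; exact mul_le_one' hF hG

lemma isProper_aeval_X_inv (p : ℝ[X]) : IsProper (aeval (RatFunc.X : RatFunc ℝ)⁻¹ p) :=
  (aeval_X_inv_mem_rhinf p).1

lemma impulseSeries_aeval_X_inv (p : ℝ[X]) :
    impulseSeries (aeval (RatFunc.X : RatFunc ℝ)⁻¹ p) = (p : PowerSeries ℝ) := by
  induction p using Polynomial.induction_on' with
  | add p q hp hq =>
    rw [map_add, impulseSeries_add (isProper_aeval_X_inv p) (isProper_aeval_X_inv q), hp, hq,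
      Polynomial.coe_add]
  | monomial n a =>
    induction n with
    | zero => simp [impulseSeries_C, RatFunc.algebraMap_eq_C]
    | succ n ih =>
      rw [← Polynomial.monomial_mul_X, map_mul, impulseSeries_mul (isProper_aeval_X_inv _)
        (isProper_aeval_X_inv _), ih, aeval_X, impulseSeries_X_inv, Polynomial.coe_mul,
        Polynomial.coe_X]

/-- Compare constant coefficients: that of the reflected numerator is its coefficient at the degree
of the denominator. This delay of one step is what makes the loop causal. -/
lemma impulseResponse_zero_eq_zero {F : RatFunc ℝ} (hF : IsStrictlyProper F) :
    impulseResponse F 0 = 0 := by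
  have h := congrArg PowerSeries.constantCoeff (impulseSeries_mul_reverse_denom (F := F) hF.le)
  rw [map_mul, ← PowerSeries.coeff_zero_eq_constantCoeff_apply, coeff_impulseSeries,
    ← PowerSeries.coeff_zero_eq_constantCoeff_apply (Polynomial.toPowerSeries (reflect _ _)),
    Polynomial.coeff_coe, Polynomial.coeff_reflect, Polynomial.revAt_zero,
    Polynomial.coeff_eq_zero_of_degree_lt (by
      rw [← Polynomial.degree_eq_natDegree F.denom_ne_zero]; exact hF)] at h
  exact (mul_eq_zero.1 h).resolve_right (constantCoeff_reverse_denom_ne_zero F)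

end ImpulseSeries

/-! ### Absolutely summable power series -/

section Summable
open Polynomial

/-- The coefficients of the power series are absolutely summable. -/
def IsSummable (f : PowerSeries ℂ) : Prop := Summable fun n => ‖PowerSeries.coeff n f‖

/-- The sum of a power series at a point. -/
noncomputable def seriesEval (f : PowerSeries ℂ) (w : ℂ) : ℂ := ∑' n, PowerSeries.coeff n f * w ^ n

lemma isSummable_polynomial (p : ℂ[X]) : IsSummable (p : PowerSeries ℂ) := by
  refine summable_of_hasFiniteSupport ((p.support : Set ℕ).toFinite.subset ?_)
  intro n hn
  simpa using hn

lemma IsSummable.mul {f g : PowerSeries ℂ} (hf : IsSummable f) (hg : IsSummable g) :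
    IsSummable (f * g) := by
  have := summable_norm_sum_mul_antidiagonal_of_summable_norm hf hg
  simpa only [IsSummable, PowerSeries.coeff_mul] using this

lemma IsSummable.norm_mul_pow {f : PowerSeries ℂ} (hf : IsSummable f) {w : ℂ} (hw : ‖w‖ ≤ 1) :
    Summable fun n => ‖PowerSeries.coeff n f * w ^ n‖ := by
  refine Summable.of_nonneg_of_le (fun _ => norm_nonneg _) (fun n => ?_) hf
  rw [norm_mul, norm_pow]
  exact mul_le_of_le_one_right (norm_nonneg _) (pow_le_one₀ (norm_nonneg _) hw)

lemma seriesEval_mul {f g : PowerSeries ℂ} (hf : IsSummable f) (hg : IsSummable g) {w : ℂ}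
    (hw : ‖w‖ ≤ 1) : seriesEval (f * g) w = seriesEval f w * seriesEval g w := by
  rw [seriesEval, seriesEval, seriesEval, tsum_mul_tsum_eq_tsum_sum_antidiagonal_of_summable_norm
    (hf.norm_mul_pow hw) (hg.norm_mul_pow hw)]
  refine tsum_congr fun n => ?_
  rw [PowerSeries.coeff_mul, Finset.sum_mul]
  refine Finset.sum_congr rfl fun q hq => ?_
  rw [← Finset.HasAntidiagonal.mem_antidiagonal.1 hq, pow_add]
  ring

lemma seriesEval_polynomial (p : ℂ[X]) (w : ℂ) : seriesEval (p : PowerSeries ℂ) w = p.eval w := by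
  rw [seriesEval, Polynomial.eval_eq_sum, Polynomial.sum, tsum_eq_sum (s := p.support)]
  · simp
  · intro n hn
    simp only [Polynomial.mem_support_iff, not_not] at hn
    simp [hn]

lemma mk_geometric_mul_one_sub (a : ℂ) :
    PowerSeries.mk (fun n => a ^ n) * (1 - PowerSeries.C a * PowerSeries.X) = 1 := by
  ext n
  cases n with
  | zero => simp [mul_sub]
  | succ n =>
    rw [mul_sub, mul_one, ← mul_assoc, map_sub, PowerSeries.coeff_succ_mul_X, mul_comm,
      PowerSeries.coeff_C_mul]
    simp [pow_succ', PowerSeries.coeff_one]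

lemma reverse_X_sub_C (a : ℂ) : (X - C a : ℂ[X]).reverse = 1 - C a * X := by
  rw [Polynomial.reverse, Polynomial.natDegree_X_sub_C, Polynomial.reflect_sub,
    Polynomial.reflect_one_X, Polynomial.reflect_C, pow_one]

/-- Each factor `1 - aX` is inverted by a geometric series, summable because `‖a‖ < 1`, and
absolutely summable series are closed under convolution. -/
lemma exists_isSummable_mul_reverse_eq_one (s : Multiset ℂ) (hs : ∀ a ∈ s, ‖a‖ < 1) :
    ∃ g : PowerSeries ℂ, IsSummable g ∧
      g * (((s.map fun a => X - C a).prod.reverse : ℂ[X]) : PowerSeries ℂ) = 1 := by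
  induction s using Multiset.induction_on with
  | empty => exact ⟨1, by simpa using isSummable_polynomial 1, by
      rw [Multiset.map_zero, Multiset.prod_zero, ← C_1, Polynomial.reverse_C]; simp⟩
  | cons a s ih =>
    obtain ⟨g, hg, h⟩ := ih fun b hb => hs b (Multiset.mem_cons_of_mem hb)
    refine ⟨PowerSeries.mk (fun n => a ^ n) * g, IsSummable.mul ?_ hg, ?_⟩
    · simpa [IsSummable] using hs a (Multiset.mem_cons_self a s)
    · rw [Multiset.map_cons, Multiset.prod_cons, Polynomial.reverse_mul_of_domain,
        reverse_X_sub_C, Polynomial.coe_mul, mul_mul_mul_comm, h, mul_one]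
      simpa using mk_geometric_mul_one_sub a

lemma exists_isSummable_mul_reverse_map_eq_one {q : ℝ[X]} (hq0 : q ≠ 0)
    (hq : ∀ z : ℂ, 1 ≤ ‖z‖ → aeval z q ≠ 0) :
    ∃ g : PowerSeries ℂ, IsSummable g ∧
      g * (((q.map (algebraMap ℝ ℂ)).reverse : ℂ[X]) : PowerSeries ℂ) = 1 := by
  set Q := q.map (algebraMap ℝ ℂ) with hQ
  have hQ0 : Q ≠ 0 := by simpa [hQ] using hq0
  obtain ⟨g, hg, h⟩ := exists_isSummable_mul_reverse_eq_one Q.roots fun a ha => by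
    by_contra hc
    refine hq a (not_lt.1 hc) ?_
    have := (Polynomial.mem_roots hQ0).1 ha
    rwa [Polynomial.IsRoot, hQ, Polynomial.eval_map_algebraMap] at this
  have hsplit : Q = C Q.leadingCoeff * (Q.roots.map fun a => X - C a).prod :=
    (IsAlgClosed.splits Q).eq_prod_roots
  refine ⟨((C Q.leadingCoeff⁻¹ : ℂ[X]) : PowerSeries ℂ) * g,
    (isSummable_polynomial _).mul hg, ?_⟩
  have e : Q.reverse = C Q.leadingCoeff * (Q.roots.map fun a => X - C a).prod.reverse := by
    conv_lhs => rw [hsplit]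
    rw [Polynomial.reverse_mul_of_domain, Polynomial.reverse_C]
  rw [e, Polynomial.coe_mul, mul_mul_mul_comm, h, mul_one, ← Polynomial.coe_mul, ← C_mul,
    inv_mul_cancel₀ (by simpa using hQ0)]
  simp

/-- The impulse response with complex coefficients. -/
noncomputable abbrev complexSeries (F : RatFunc ℝ) : PowerSeries ℂ :=
  PowerSeries.map (algebraMap ℝ ℂ) (impulseSeries F)

lemma complexSeries_mul_reverse_denom {F : RatFunc ℝ} (hF : IsProper F) :
    complexSeries F * (((F.denom.map (algebraMap ℝ ℂ)).reverse : ℂ[X]) : PowerSeries ℂ) =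
      (((F.num.map (algebraMap ℝ ℂ)).reflect F.denom.natDegree : ℂ[X]) : PowerSeries ℂ) := by
  have h := congrArg (PowerSeries.map (algebraMap ℝ ℂ)) (impulseSeries_mul_reverse_denom hF)
  rw [map_mul, ← Polynomial.polynomial_map_coe, ← Polynomial.polynomial_map_coe] at h
  rw [Polynomial.reverse, Polynomial.reflect_map, Polynomial.reflect_map,
    Polynomial.natDegree_map]
  exact h

lemma isSummable_complexSeries {F : RatFunc ℝ} (hF : F ∈ rhinf) : IsSummable (complexSeries F) := by
  obtain ⟨g, hg, h⟩ := exists_isSummable_mul_reverse_map_eq_one F.denom_ne_zero hF.2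
  have e := complexSeries_mul_reverse_denom hF.1
  have : complexSeries F =
      (((F.num.map (algebraMap ℝ ℂ)).reflect F.denom.natDegree : ℂ[X]) : PowerSeries ℂ) * g := by
    rw [← e, mul_assoc, mul_comm _ g, h, mul_one]
  rw [this]
  exact (isSummable_polynomial _).mul hg

/-- Evaluate `complexSeries_mul_reverse_denom` at `z⁻¹`. Absolute summability makes evaluation
multiplicative on the closed disc, so the unit circle is included. -/
lemma seriesEval_complexSeries {F : RatFunc ℝ} (hF : F ∈ rhinf) {z : ℂ} (hz : 1 ≤ ‖z‖) :
    seriesEval (complexSeries F) z⁻¹ = evalAt z F := by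
  have hz0 : z ≠ 0 := norm_pos_iff.1 (by linarith)
  have hw : ‖z⁻¹‖ ≤ 1 := by rw [norm_inv]; exact inv_le_one_of_one_le₀ hz
  let : Invertible z := invertibleOfNonzero hz0
  have e := congrArg (fun f => seriesEval f z⁻¹) (complexSeries_mul_reverse_denom hF.1)
  rw [seriesEval_mul (isSummable_complexSeries hF) (isSummable_polynomial _) hw,
    seriesEval_polynomial, seriesEval_polynomial, Polynomial.reverse, Polynomial.natDegree_map,
    Polynomial.reflect_map, Polynomial.reflect_map, Polynomial.eval_map,
    Polynomial.eval_map] at e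
  have h1 := Polynomial.eval₂_reflect_mul_pow (algebraMap ℝ ℂ) z F.denom.natDegree F.denom le_rfl
  have h2 := Polynomial.eval₂_reflect_mul_pow (algebraMap ℝ ℂ) z F.denom.natDegree F.num
    (natDegree_num_le hF.1)
  rw [invOf_eq_inv] at h1 h2
  rw [evalAt, RatFunc.eval, eq_div_iff (show Polynomial.eval₂ (algebraMap ℝ ℂ) z F.denom ≠ 0 from hF.2 z hz), ← h1, ← h2, ← mul_assoc, e]

end Summable

/-! ### Parseval's identity -/

section Parseval
open Polynomial Filter Topology

lemma integral_normSq_eval_circle (p : ℂ[X]) :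
    (2 * Real.pi)⁻¹ * ∫ θ in (-Real.pi)..Real.pi, ‖p.eval (Complex.exp (θ * Complex.I))⁻¹‖ ^ 2 =
      ∑ i ∈ p.support, ‖p.coeff i‖ ^ 2 := by
  rw [Polynomial.sum_sq_norm_coeff_eq_circleAverage, Real.circleAverage, smul_eq_mul]
  congr 1
  -- The circle average runs over `[0, 2π]` at `e^{iθ}`, the integral here over `[-π, π]` at
  -- `e^{-iθ}`; reflection and periodicity reconcile them.
  set h : ℝ → ℝ := fun θ => ‖p.eval (circleMap 0 1 θ)‖ ^ 2 with hh
  have hper : Function.Periodic h (2 * Real.pi) := fun θ => by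
    simp only [hh]; rw [periodic_circleMap]
  have h1 : ∀ θ : ℝ, ‖p.eval (Complex.exp (θ * Complex.I))⁻¹‖ ^ 2 = h (-θ) := fun θ => by
    simp [hh, circleMap, Complex.exp_neg]
  simp_rw [h1]
  rw [intervalIntegral.integral_comp_neg, neg_neg]
  have := hper.intervalIntegral_add_eq (-Real.pi) 0
  rw [zero_add, show -Real.pi + 2 * Real.pi = Real.pi by ring] at this
  exact this

/-- Parseval for the polynomial truncations passes to the limit by dominated convergence, with the
constant bound `(∑ ‖fₙ‖)²`. -/
lemma hasSum_sq_of_summable_norm {f : PowerSeries ℂ} (hf : IsSummable f) :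
    HasSum (fun n => ‖PowerSeries.coeff n f‖ ^ 2) ((2 * Real.pi)⁻¹ *
      ∫ θ in (-Real.pi)..Real.pi, ‖seriesEval f (Complex.exp (θ * Complex.I))⁻¹‖ ^ 2) := by
  have hsum : Summable fun n => ‖PowerSeries.coeff n f‖ ^ 2 := by
    refine Summable.of_norm_bounded_eventually_nat hf ?_
    filter_upwards [hf.tendsto_atTop_zero.eventually_le_const (zero_lt_one)] with n hn
    rw [Real.norm_of_nonneg (by positivity), sq]
    exact mul_le_of_le_one_left (norm_nonneg _) hn
  rw [hsum.hasSum_iff_tendsto_nat]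
  have hw : ∀ θ : ℝ, ‖(Complex.exp (θ * Complex.I))⁻¹‖ ≤ 1 := fun θ => by
    rw [norm_inv, Complex.norm_exp_ofReal_mul_I, inv_one]
  have htrunc : ∀ N, ∑ n ∈ Finset.range N, ‖PowerSeries.coeff n f‖ ^ 2 = (2 * Real.pi)⁻¹ *
      ∫ θ in (-Real.pi)..Real.pi,
        ‖(PowerSeries.trunc N f).eval (Complex.exp (θ * Complex.I))⁻¹‖ ^ 2 := fun N => by
    rw [integral_normSq_eval_circle]
    symm
    rw [Finset.sum_subset (s₂ := Finset.range N)]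
    · refine Finset.sum_congr rfl fun n hn => ?_
      rw [PowerSeries.coeff_trunc, if_pos (Finset.mem_range.1 hn)]
    · intro n hn
      by_contra hc
      simp [PowerSeries.coeff_trunc, Finset.mem_range.not.1 hc] at hn
    · intro n _ hn
      simp only [Polynomial.mem_support_iff, not_not] at hn
      simp [hn]
  simp_rw [htrunc]
  refine Tendsto.const_mul _ ?_
  refine intervalIntegral.tendsto_integral_filter_of_dominated_convergence
    (fun _ => (∑' n, ‖PowerSeries.coeff n f‖) ^ 2) ?_ ?_ ?_ ?_
  · refine Eventually.of_forall fun N => Continuous.aestronglyMeasurable ?_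
    have : Continuous fun θ : ℝ => (Complex.exp (θ * Complex.I))⁻¹ :=
      Continuous.inv₀ (by fun_prop) fun _ => Complex.exp_ne_zero _
    fun_prop
  · refine Eventually.of_forall fun N => Eventually.of_forall fun θ _ => ?_
    rw [Real.norm_of_nonneg (by positivity)]
    refine pow_le_pow_left₀ (norm_nonneg _) ?_ 2
    rw [Polynomial.eval, PowerSeries.eval₂_trunc_eq_sum_range]
    refine (norm_sum_le_of_le _ fun n _ => ?_).trans (hf.sum_le_tsum _ fun _ _ => norm_nonneg _)
    rw [norm_mul, norm_pow]
    exact mul_le_of_le_one_right (norm_nonneg _) (pow_le_one₀ (norm_nonneg _) (hw θ))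
  · exact intervalIntegrable_const
  · refine Eventually.of_forall fun θ _ => ?_
    refine (Tendsto.norm ?_).pow 2
    simp_rw [Polynomial.eval, PowerSeries.eval₂_trunc_eq_sum_range]
    exact (hf.norm_mul_pow (hw θ)).of_norm.hasSum.tendsto_sum_nat

/-- Parseval's identity for the `H₂` norm of a proper stable transfer function. -/
lemma hasSum_sq_impulseResponse {F : RatFunc ℝ} (hF : F ∈ rhinf) :
    HasSum (fun n => impulseResponse F n ^ 2) ((2 * Real.pi)⁻¹ *
      ∫ θ in (-Real.pi)..Real.pi, ‖evalAt (Complex.exp (θ * Complex.I)) F‖ ^ 2) := by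
  have h := hasSum_sq_of_summable_norm (isSummable_complexSeries hF)
  simp_rw [fun θ : ℝ => seriesEval_complexSeries hF
    (z := Complex.exp (θ * Complex.I)) (by rw [Complex.norm_exp_ofReal_mul_I])] at h
  simpa using h

lemma continuous_evalAt_circle {F : RatFunc ℝ} (hF : F ∈ rhinf) :
    Continuous fun θ : ℝ => evalAt (Complex.exp (θ * Complex.I)) F := by
  have h : ∀ p : ℝ[X], Continuous fun θ : ℝ =>
      Polynomial.eval₂ (algebraMap ℝ ℂ) (Complex.exp (θ * Complex.I)) p := fun p => by
    simp_rw [← Polynomial.eval_map]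
    fun_prop
  exact (h _).div (h _) fun θ => hF.2 _ (by rw [Complex.norm_exp_ofReal_mul_I])

end Parseval

/-! ### The spectral density of the channel uncertainty -/

namespace Channel
open Polynomial ComplexConjugate

variable (c : Channel)

/-- The generating polynomial of the mean response. -/
noncomputable def meanPoly : ℝ[X] := ∑ i, C (c.prob i * c.weight i) * X ^ (i : ℕ)

/-- The generating polynomial of the deviation of the response to a datum with delay `j`. -/
noncomputable def deviationPoly (j : Fin (c.maxDelay + 1)) : ℝ[X] :=
  C (c.weight j) * X ^ (j : ℕ) - c.meanPoly

lemma coeff_meanPoly (n : ℕ) : c.meanPoly.coeff n = c.meanResponse n := by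
  simp only [meanPoly, meanResponse, response, finsetSum_coeff, coeff_C_mul, coeff_X_pow]
  refine Finset.sum_congr rfl fun i _ => ?_
  rcases eq_or_ne (i : ℕ) n with h | h
  · simp [h]
  · simp [h, h.symm]

lemma coeff_deviationPoly (j : Fin (c.maxDelay + 1)) (n : ℕ) :
    (c.deviationPoly j).coeff n = c.deviation j n := by
  simp only [deviationPoly, deviation, response, coeff_sub, coeff_meanPoly, coeff_C_mul,
    coeff_X_pow]
  rcases eq_or_ne (j : ℕ) n with h | h
  · simp [h]
  · simp [h, h.symm]

lemma deviation_eq_zero (j : Fin (c.maxDelay + 1)) {n : ℕ} (hn : c.maxDelay < n) :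
    c.deviation j n = 0 := by
  have h : ∀ i : Fin (c.maxDelay + 1), c.response i n = 0 := fun i =>
    if_neg (by have := i.2; omega)
  simp [deviation, meanResponse, h]

lemma sum_prob_mul_deviation (n : ℕ) : ∑ j, c.prob j * c.deviation j n = 0 := by
  simp only [deviation, mul_sub, Finset.sum_sub_distrib, ← Finset.sum_mul, c.prob_sum, one_mul]
  exact sub_self _

lemma meanTF_eq_aeval : c.meanTF = aeval (RatFunc.X : RatFunc ℝ)⁻¹ c.meanPoly := by
  simp [meanTF, meanPoly, RatFunc.algebraMap_eq_C, mul_comm]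

lemma aeval_deviationPoly (j : Fin (c.maxDelay + 1)) (w : ℂ) :
    aeval w (c.deviationPoly j) =
      ∑ a ∈ Finset.range (c.maxDelay + 1), (c.deviation j a : ℂ) * w ^ a := by
  rw [aeval_eq_sum_range' (n := c.maxDelay + 1)]
  · simp [coeff_deviationPoly]
  · rw [Nat.lt_succ_iff, natDegree_le_iff_coeff_eq_zero]
    intro n hn
    rw [coeff_deviationPoly, c.deviation_eq_zero j hn]

/-- The transform of an autocorrelation is the product of the transforms at `z` and `z⁻¹`: each pair
of times `(a, b)` contributes to exactly one lag, `b - a`. -/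
lemma evalAt_spectralDensity {z : ℂ} (hz : z ≠ 0) :
    evalAt z c.spectralDensity =
      ∑ j, c.prob j * (aeval z (c.deviationPoly j) * aeval z⁻¹ (c.deviationPoly j)) := by
  have hX : ∀ l : ℤ, (RatFunc.X : RatFunc ℝ) ^ l ∈ regularAt z ∧
      evalAt z ((RatFunc.X : RatFunc ℝ) ^ l) = z ^ l := by
    have hpow : ∀ n : ℕ, (RatFunc.X : RatFunc ℝ) ^ n ∈ regularAt z ∧
        evalAt z ((RatFunc.X : RatFunc ℝ) ^ n) = z ^ n := fun n => by
      have h : (RatFunc.X : RatFunc ℝ) ^ n ∈ regularAt z :=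
        (regularAt z).pow_mem (X_mem_regularAt z) n
      refine ⟨h, ?_⟩
      have := evalAt_aeval (X_mem_regularAt z) (X ^ n : ℝ[X])
      simpa using this
    intro l
    obtain ⟨n, rfl | rfl⟩ := l.eq_nat_or_neg
    · simpa using hpow n
    · have h0 : evalAt z ((RatFunc.X : RatFunc ℝ) ^ n) ≠ 0 := by
        rw [(hpow n).2]; exact pow_ne_zero _ hz
      rw [zpow_neg, zpow_natCast, zpow_neg, zpow_natCast]
      exact ⟨inv_mem_regularAt h0, by rw [evalAt_inv (hpow n).1 h0, (hpow n).2]⟩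
  rw [spectralDensity, evalAt_sum _ fun l _ => (regularAt z).mul_mem (C_mem_regularAt z _) (hX _).1]
  have h1 : ∀ l : ℤ, evalAt z (RatFunc.C (c.autocorr l) * (RatFunc.X : RatFunc ℝ) ^ (-l)) =
      ∑ j, (c.prob j : ℂ) * ∑ a ∈ Finset.range (c.maxDelay + 1),
        ∑ b ∈ Finset.range (c.maxDelay + 1), if l = (b : ℤ) - a then
          (c.deviation j a : ℂ) * z ^ a * (c.deviation j b * z⁻¹ ^ b) else 0 := fun l => by
    rw [evalAt_mul (C_mem_regularAt z _) (hX _).1, (hX _).2, evalAt, RatFunc.eval_C, autocorr,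
      Complex.coe_algebraMap, Complex.ofReal_sum, Finset.sum_mul]
    refine Finset.sum_congr rfl fun j _ => ?_
    rw [Complex.ofReal_mul, mul_assoc, Complex.ofReal_sum, Finset.sum_mul]
    congr 1
    refine Finset.sum_congr rfl fun a _ => ?_
    rw [Complex.ofReal_sum, Finset.sum_mul]
    refine Finset.sum_congr rfl fun b _ => ?_
    by_cases h : l = (b : ℤ) - a
    · rw [if_pos (by omega), if_pos h, h, neg_sub, zpow_sub₀ hz, zpow_natCast, zpow_natCast,
        inv_pow, Complex.ofReal_mul]
      ring
    · rw [if_neg (by omega), if_neg h]; simp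
  simp_rw [h1]
  rw [Finset.sum_comm]
  refine Finset.sum_congr rfl fun j _ => ?_
  rw [← Finset.mul_sum, aeval_deviationPoly, aeval_deviationPoly, Finset.sum_mul_sum]
  congr 1
  rw [Finset.sum_comm]
  refine Finset.sum_congr rfl fun a ha => ?_
  rw [Finset.sum_comm]
  refine Finset.sum_congr rfl fun b hb => ?_
  rw [Finset.sum_ite_eq', if_pos]
  rw [Finset.mem_range] at ha hb
  rw [Finset.mem_Icc]
  omega

lemma aeval_mul_aeval_inv_of_norm_eq_one {z : ℂ} (hz : ‖z‖ = 1) (p : ℝ[X]) :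
    aeval z p * aeval z⁻¹ p = ((‖aeval z⁻¹ p‖ ^ 2 : ℝ) : ℂ) := by
  have h : z = conj z⁻¹ := by rw [Complex.inv_eq_conj hz, Complex.conj_conj]
  conv_lhs => enter [1]; rw [h, Polynomial.aeval_conj]
  rw [Complex.conj_mul']
  norm_cast

/-- On the unit circle `z⁻¹` is the conjugate of `z`, so both expressions for the spectral density
become squared moduli. -/
lemma IsSpectralFactor.normSq_evalAt {c : Channel} {Φ : RatFunc ℝ} (hΦ : c.IsSpectralFactor Φ)
    {z : ℂ} (hz : ‖z‖ = 1) :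
    ‖evalAt z Φ‖ ^ 2 = ∑ j, c.prob j * ‖aeval z⁻¹ (c.deviationPoly j)‖ ^ 2 := by
  obtain ⟨φ, -, rfl, -, hS⟩ := hΦ
  have hz0 : z ≠ 0 := norm_pos_iff.1 (by linarith)
  have h := c.evalAt_spectralDensity hz0
  rw [hS, evalAt_mul (aeval_mem_regularAt (X_mem_regularAt z) _)
    (aeval_mem_regularAt (X_inv_mem_regularAt hz0) _), evalAt_aeval (X_mem_regularAt z),
    evalAt_aeval (X_inv_mem_regularAt hz0), evalAt_X_inv hz0] at h
  rw [evalAt_aeval (X_inv_mem_regularAt hz0), evalAt_X_inv hz0]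
  have hX : evalAt z RatFunc.X = z := by simp
  rw [hX, aeval_mul_aeval_inv_of_norm_eq_one hz] at h
  simp_rw [aeval_mul_aeval_inv_of_norm_eq_one hz] at h
  exact_mod_cast h

lemma IsSpectralFactor.mem_rhinf {c : Channel} {Φ : RatFunc ℝ} (hΦ : c.IsSpectralFactor Φ) :
    Φ ∈ rhinf := by
  obtain ⟨φ, -, rfl, -⟩ := hΦ
  exact aeval_X_inv_mem_rhinf φ

lemma evalAt_meanTF {z : ℂ} (hz : z ≠ 0) : evalAt z c.meanTF = aeval z⁻¹ c.meanPoly := by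
  rw [meanTF_eq_aeval, evalAt_aeval (X_inv_mem_regularAt hz), evalAt_X_inv hz]

lemma exists_prob_mul_weight_ne_zero {c : Channel} (hH : c.meanTF ≠ 0) :
    ∃ i, c.prob i * c.weight i ≠ 0 := by
  by_contra! h
  exact hH (by simp [meanTF_eq_aeval, meanPoly, h])

/-- The mean channel and the spectral factor have no common zero outside the open unit disc. -/
lemma IsSpectralFactor.evalAt_ne_zero {c : Channel} {Φ : RatFunc ℝ} (hΦ : c.IsSpectralFactor Φ)
    (hH : c.meanTF ≠ 0) {z : ℂ} (hz : 1 ≤ ‖z‖) (hzH : evalAt z c.meanTF = 0) :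
    evalAt z Φ ≠ 0 := by
  have hz0 : z ≠ 0 := norm_pos_iff.1 (by linarith)
  obtain ⟨i, hi⟩ := exists_prob_mul_weight_ne_zero hH
  have hpi : 0 < c.prob i := lt_of_le_of_ne (c.prob_nonneg i) (Ne.symm (left_ne_zero_of_mul hi))
  have hwi := right_ne_zero_of_mul hi
  -- A zero of `Φ` on the circle kills a sum of nonnegative terms, hence the deviation for every
  -- delay of positive probability. At a zero of `H` this would force `αᵢ = 0`.
  have key : ∀ w : ℂ, ‖w‖ = 1 → evalAt w Φ = 0 → aeval w⁻¹ (c.deviationPoly i) = 0 := by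
    intro w hw h0
    have h := hΦ.normSq_evalAt hw
    rw [h0, norm_zero, zero_pow two_ne_zero, eq_comm, Finset.sum_eq_zero_iff_of_nonneg
      fun j _ => mul_nonneg (c.prob_nonneg j) (sq_nonneg _)] at h
    have := (mul_eq_zero.1 (h i (Finset.mem_univ i))).resolve_left hpi.ne'
    simpa using this
  rcases hz.eq_or_lt with h1 | h1
  · intro h0
    have := key z h1.symm h0
    rw [deviationPoly, map_sub, ← c.evalAt_meanTF hz0, hzH] at this
    simp [hz0, hwi] at this
  -- The minimum phase condition is empty for `Φ = 0`. In that case the deviation for delay `i`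
  -- vanishes at infinitely many points of the circle, hence identically, and `H = αᵢ z⁻ⁱ` has no
  -- zeros at all.
  · by_cases hΦ0 : Φ = 0
    · exfalso
      have hdev : c.deviationPoly i = 0 := by
        have hmap : (c.deviationPoly i).map (algebraMap ℝ ℂ) = 0 := by
          refine Polynomial.eq_zero_of_infinite_isRoot _ (Set.Infinite.mono ?_
            (s := Set.range fun n : ℕ => (Complex.exp ((((n : ℝ) + 1)⁻¹ : ℝ) * Complex.I))) ?_)
          · rintro _ ⟨n, rfl⟩
            have := key (Complex.exp ((((n : ℝ) + 1)⁻¹ : ℝ) * Complex.I))⁻¹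
              (by rw [norm_inv, Complex.norm_exp_ofReal_mul_I, inv_one]) (by simp [hΦ0])
            rw [inv_inv] at this
            rwa [Set.mem_ofPred_eq, Polynomial.IsRoot, Polynomial.eval_map_algebraMap]
          · refine Set.infinite_range_of_injective fun m n hmn => ?_
            have hb : ∀ k : ℕ, ((k : ℝ) + 1)⁻¹ ∈ Set.Ioc (-Real.pi) Real.pi := fun k => by
              have h0 : (0 : ℝ) < ((k : ℝ) + 1)⁻¹ := by positivity
              have h2 : ((k : ℝ) + 1)⁻¹ ≤ 1 := inv_le_one_of_one_le₀ (by
                have : (0 : ℝ) ≤ k := k.cast_nonneg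
                linarith)
              have := Real.pi_gt_three
              constructor <;> linarith
            have := Complex.exp_inj_of_neg_pi_lt_of_le_pi
              (x := (((m : ℝ) + 1)⁻¹ : ℝ) * Complex.I) (y := (((n : ℝ) + 1)⁻¹ : ℝ) * Complex.I)
              (by rw [Complex.im_ofReal_mul, Complex.I_im, mul_one]; exact (hb m).1) (by rw [Complex.im_ofReal_mul, Complex.I_im, mul_one]; exact (hb m).2)
              (by rw [Complex.im_ofReal_mul, Complex.I_im, mul_one]; exact (hb n).1) (by rw [Complex.im_ofReal_mul, Complex.I_im, mul_one]; exact (hb n).2) hmn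
            simpa using this
        exact (Polynomial.map_eq_zero _).1 hmap
      have hpoly : c.meanPoly = C (c.weight i) * X ^ (i : ℕ) := (sub_eq_zero.1 hdev).symm
      rw [c.evalAt_meanTF hz0, hpoly] at hzH
      simp [hz0, hwi] at hzH
    · obtain ⟨φ, -, rfl, hφ, -⟩ := hΦ
      rw [evalAt_aeval (X_inv_mem_regularAt hz0), evalAt_X_inv hz0]
      exact hφ (by rintro rfl; simp at hΦ0) z h1

/-- The mean energy at lag `l` of the response of `G` to the channel uncertainty. -/
noncomputable def gain (G : RatFunc ℝ) (l : ℕ) : ℝ :=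
  ∑ j, c.prob j * PowerSeries.coeff l (impulseSeries G * (c.deviationPoly j : PowerSeries ℝ)) ^ 2

lemma gain_nonneg (G : RatFunc ℝ) (l : ℕ) : 0 ≤ c.gain G l :=
  Finset.sum_nonneg fun j _ => mul_nonneg (c.prob_nonneg j) (sq_nonneg _)

/-- The total mean energy of the response is the squared `H₂` norm of `G Φ`. -/
lemma IsSpectralFactor.exists_hasSum_gain {c : Channel} {Φ : RatFunc ℝ}
    (hΦ : c.IsSpectralFactor Φ) {G : RatFunc ℝ} (hG : G ∈ rhinf) :
    ∃ s : ℝ, HasSum (c.gain G) s ∧ h2NormSq (G * Φ) = ENNReal.ofReal s := by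
  have hω : ∀ j, G * aeval (RatFunc.X : RatFunc ℝ)⁻¹ (c.deviationPoly j) ∈ rhinf := fun j =>
    rhinf.mul_mem hG (aeval_X_inv_mem_rhinf _)
  have hcoeff : ∀ j l, PowerSeries.coeff l
      (impulseSeries G * (c.deviationPoly j : PowerSeries ℝ)) =
      impulseResponse (G * aeval (RatFunc.X : RatFunc ℝ)⁻¹ (c.deviationPoly j)) l := fun j l => by
    rw [← coeff_impulseSeries, impulseSeries_mul hG.1 (isProper_aeval_X_inv _),
      impulseSeries_aeval_X_inv]
  refine ⟨_, ?_, if_pos (rhinf.mul_mem hG hΦ.mem_rhinf)⟩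
  -- Parseval for each `G ω_j`, averaged over `j`. What remains is to identify the averaged
  -- integrand with `|GΦ|²`.
  have hsum := hasSum_sum (s := Finset.univ) fun j (_ : j ∈ Finset.univ) =>
    (hasSum_sq_impulseResponse (hω j)).mul_left (c.prob j)
  simp_rw [← hcoeff] at hsum
  refine Eq.mp (congrArg (fun t => HasSum (c.gain G) t) ?_) hsum
  symm
  simp_rw [mul_left_comm _ (2 * Real.pi)⁻¹, ← Finset.mul_sum]
  congr 1
  simp_rw [← intervalIntegral.integral_const_mul]
  rw [← intervalIntegral.integral_finsetSum]
  · refine intervalIntegral.integral_congr fun θ _ => ?_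
    have hz : ‖Complex.exp (θ * Complex.I)‖ = 1 := Complex.norm_exp_ofReal_mul_I θ
    have hz0 := Complex.exp_ne_zero (θ * Complex.I)
    have hGr := mem_regularAt_of_mem_rhinf hG hz.ge
    have hmul := evalAt_mul hGr (mem_regularAt_of_mem_rhinf hΦ.mem_rhinf hz.ge)
    rw [evalAt] at hmul
    rw [hmul, norm_mul, mul_pow, hΦ.normSq_evalAt hz, Finset.mul_sum]
    refine Finset.sum_congr rfl fun j _ => ?_
    rw [evalAt_mul hGr (aeval_mem_regularAt (X_inv_mem_regularAt hz0) _),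
      evalAt_aeval (X_inv_mem_regularAt hz0), evalAt_X_inv hz0, norm_mul, mul_pow]
    ring
  · intro j _
    exact ((continuous_const.mul ((continuous_evalAt_circle (hω j)).norm.pow 2))).intervalIntegrable
      _ _

end Channel

/-! ### The networked loop along one path of the delays -/

section Paths
open Finset.HasAntidiagonal (antidiagonal mem_antidiagonal)

/-- Associativity of convolution for a general kernel: the response of the channel depends on the
delay drawn at the sending time, so it is not a product of power series. -/
lemma sum_antidiagonal_assoc (k : ℕ) (f : ℕ → ℕ → ℕ → ℝ) :
    ∑ q ∈ antidiagonal k, ∑ r ∈ antidiagonal q.2, f q.1 r.1 r.2 =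
      ∑ q ∈ antidiagonal k, ∑ r ∈ antidiagonal q.1, f r.1 r.2 q.2 := by
  rw [Finset.sum_sigma', Finset.sum_sigma']
  refine Finset.sum_nbij' (fun x => ⟨(x.1.1 + x.2.1, x.2.2), (x.1.1, x.2.1)⟩)
    (fun x => ⟨(x.2.1, x.2.2 + x.1.2), (x.2.2, x.1.2)⟩) ?_ ?_ ?_ ?_ ?_
  · rintro ⟨⟨a, b⟩, ⟨d, e⟩⟩ h
    simp only [Finset.mem_sigma, mem_antidiagonal] at h ⊢
    exact ⟨by omega, trivial⟩
  · rintro ⟨⟨a, b⟩, ⟨d, e⟩⟩ h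
    simp only [Finset.mem_sigma, mem_antidiagonal] at h ⊢
    exact ⟨by omega, trivial⟩
  · rintro ⟨⟨a, b⟩, ⟨d, e⟩⟩ h
    simp only [Finset.mem_sigma, mem_antidiagonal] at h
    obtain ⟨_, rfl⟩ := h
    rfl
  · rintro ⟨⟨a, b⟩, ⟨d, e⟩⟩ h
    simp only [Finset.mem_sigma, mem_antidiagonal] at h
    obtain ⟨_, rfl⟩ := h
    rfl
  · rintro ⟨⟨a, b⟩, ⟨d, e⟩⟩ h
    rfl

/-- The response of the channel uncertainty filtered by `G`, at lag `l`, to a datum with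
delay `j`. -/
noncomputable def filteredDeviation (c : Channel) (G : RatFunc ℝ) (l : ℕ)
    (j : Fin (c.maxDelay + 1)) : ℝ :=
  PowerSeries.coeff l (impulseSeries G * (c.deviationPoly j : PowerSeries ℝ))

lemma filteredDeviation_eq_sum (c : Channel) (G : RatFunc ℝ) (l : ℕ) (j : Fin (c.maxDelay + 1)) :
    filteredDeviation c G l j =
      ∑ q ∈ antidiagonal l, impulseResponse G q.1 * c.deviation j q.2 := by
  simp [filteredDeviation, PowerSeries.coeff_mul, Channel.coeff_deviationPoly]

lemma filteredDeviation_zero (c : Channel) {G : RatFunc ℝ} (hG : IsStrictlyProper G)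
    (j : Fin (c.maxDelay + 1)) : filteredDeviation c G 0 j = 0 := by
  simp [filteredDeviation_eq_sum, impulseResponse_zero_eq_zero hG]

/-- Filtering is linear, so the zero mean of the deviation survives. This is the source of the
orthogonality of the contributions of different data. -/
lemma sum_prob_mul_filteredDeviation (c : Channel) (G : RatFunc ℝ) (l : ℕ) :
    ∑ j, c.prob j * filteredDeviation c G l j = 0 := by
  simp_rw [filteredDeviation_eq_sum, Finset.mul_sum, mul_left_comm]
  rw [Finset.sum_comm]
  simp_rw [← Finset.mul_sum, c.sum_prob_mul_deviation]
  simp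

/-! ### The nominal closed loop and its signals. -/

variable {c : Channel} {P K : RatFunc ℝ}

lemma impulseSeries_meanTF (c : Channel) : impulseSeries c.meanTF = PowerSeries.mk c.meanResponse := by
  rw [Channel.meanTF_eq_aeval, impulseSeries_aeval_X_inv]
  ext n
  simp [Channel.coeff_meanPoly]

lemma inftyVal_one_add {F : RatFunc ℝ} (hF : inftyVal F < 1) : inftyVal (1 + F) = 1 := by
  rw [Valuation.map_add_eq_of_lt_left, map_one]
  rwa [map_one]

lemma inftyVal_loop_lt_one (hP : IsStrictlyProper P) (hK : IsProper K) :
    inftyVal (P * K) < 1 := by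
  rw [map_mul]
  exact mul_lt_one_of_lt_of_le (isStrictlyProper_iff_inftyVal_lt_one.1 hP)
    (isProper_iff_inftyVal_le_one.1 hK)

lemma inftyVal_one_add_loop (hP : IsStrictlyProper P) (hK : IsProper K) :
    inftyVal (1 + P * K * c.meanTF) = 1 := by
  apply inftyVal_one_add
  rw [map_mul]
  exact mul_lt_one_of_lt_of_le (inftyVal_loop_lt_one hP hK)
    (isProper_iff_inftyVal_le_one.1 c.meanTF_mem_rhinf.1)

lemma isStrictlyProper_nominal (hP : IsStrictlyProper P) (hK : IsProper K) :
    IsStrictlyProper (nominal c P K) := by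
  rw [isStrictlyProper_iff_inftyVal_lt_one, nominal, map_mul, map_inv₀,
    inftyVal_one_add_loop hP hK, inv_one, mul_one]
  exact inftyVal_loop_lt_one hP hK

lemma nominal_mem_rhinf (hP : IsStrictlyProper P) (hK : IsProper K)
    (h : IsStable (nominal c P K)) : nominal c P K ∈ rhinf :=
  ⟨(isStrictlyProper_nominal hP hK).le, h⟩

lemma impulseSeries_nominal (hP : IsStrictlyProper P) (hK : IsProper K) :
    impulseSeries (nominal c P K) *
        (1 + impulseSeries P * impulseSeries K * impulseSeries c.meanTF) =
      impulseSeries P * impulseSeries K := by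
  have hPp : IsProper P := hP.le
  have hH : IsProper c.meanTF := c.meanTF_mem_rhinf.1
  have hPK := isProper_mul hPp hK
  have h1 : inftyVal (1 + P * K * c.meanTF) = 1 := inftyVal_one_add_loop hP hK
  have hone : IsProper (1 : RatFunc ℝ) := isProper_iff_inftyVal_le_one.2 (map_one _).le
  have h0 : (1 + P * K * c.meanTF) ≠ 0 := by
    intro h; rw [h, map_zero] at h1; exact zero_ne_one h1
  rw [← impulseSeries_mul hPp hK, ← impulseSeries_mul hPK hH, ← impulseSeries_one,
    ← impulseSeries_add hone (isProper_mul hPK hH),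
    ← impulseSeries_mul (isStrictlyProper_nominal hP hK).le
      (isProper_iff_inftyVal_le_one.2 h1.le), nominal, mul_assoc, inv_mul_cancel₀ h0, mul_one]

/-- The control signal as the response of the nominal system to the input and the output of the
channel uncertainty. -/
lemma IsLoopResponse.control_eq {τ : ℕ → Fin (c.maxDelay + 1)} {v y u ud d : ℕ → ℝ}
    (hP : IsStrictlyProper P) (hK : IsProper K) (h : IsLoopResponse c P K τ v y u ud d) (k : ℕ) :
    u k = (∑ q ∈ antidiagonal k, impulseResponse (nominal c P K) q.1 * v q.2) -
      ∑ q ∈ antidiagonal k, filteredDeviation c (nominal c P K) q.1 (τ q.2) * u q.2 := by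
  set G := nominal c P K with hG
  have hY : PowerSeries.mk y = impulseSeries P * (PowerSeries.mk v - PowerSeries.mk ud) := by
    ext n; simp [PowerSeries.coeff_mul, h.plant n]
  have hU : PowerSeries.mk u = impulseSeries K * PowerSeries.mk y := by
    ext n; simp [PowerSeries.coeff_mul, h.controller n]
  have hD : PowerSeries.mk ud =
      impulseSeries c.meanTF * PowerSeries.mk u + PowerSeries.mk d := by
    ext n
    rw [impulseSeries_meanTF]
    simp only [PowerSeries.coeff_mk, map_add, PowerSeries.coeff_mul, h.channel n, h.uncertainty n,
      ← Finset.sum_add_distrib]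
    refine Finset.sum_congr rfl fun q _ => ?_
    rw [Channel.deviation]; ring
  have hmain : PowerSeries.mk u = impulseSeries G * (PowerSeries.mk v - PowerSeries.mk d) := by
    have e := impulseSeries_nominal (c := c) hP hK
    have h0 : (1 + impulseSeries P * impulseSeries K * impulseSeries c.meanTF) ≠ 0 := by
      intro h0
      have h1 := congrArg PowerSeries.constantCoeff h0
      have hp0 : PowerSeries.constantCoeff (impulseSeries P) = 0 := by
        rw [← PowerSeries.coeff_zero_eq_constantCoeff_apply, coeff_impulseSeries,
          impulseResponse_zero_eq_zero hP]
      simp [hp0] at h1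
    -- After multiplication by `1 + PKH` the claim reads `u(1 + PKH) = PK(v - d)`, which is the loop
    -- with `y` and `ud` eliminated.
    apply mul_right_cancel₀ h0
    have e2 : PowerSeries.mk u = impulseSeries K * (impulseSeries P * (PowerSeries.mk v -
        (impulseSeries c.meanTF * PowerSeries.mk u + PowerSeries.mk d))) := by
      rw [← hD, ← hY, ← hU]
    linear_combination e2 - (PowerSeries.mk v - PowerSeries.mk d) * e
  have hk := congrArg (PowerSeries.coeff k) hmain
  rw [mul_sub, map_sub, PowerSeries.coeff_mul, PowerSeries.coeff_mul] at hk
  simp only [PowerSeries.coeff_mk, coeff_impulseSeries] at hk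
  rw [hk]
  congr 1
  simp_rw [h.uncertainty, Finset.mul_sum, filteredDeviation_eq_sum, Finset.sum_mul]
  rw [sum_antidiagonal_assoc k fun a i n => impulseResponse G a * (c.deviation (τ n) i * u n)]
  simp_rw [mul_assoc]

/-- The control signal of the loop, computed recursively. -/
noncomputable def loopControl (c : Channel) (P K : RatFunc ℝ) (τ : ℕ → Fin (c.maxDelay + 1))
    (v : ℕ → ℝ) : ℕ → ℝ :=
  WellFounded.fix (C := fun _ => ℝ) Nat.lt_wfRel.wf fun k w =>
    ∑ q ∈ antidiagonal k, PowerSeries.coeff q.1 (impulseSeries K * impulseSeries P) *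
      (v q.2 - ∑ r ∈ antidiagonal q.2,
        c.response (τ r.2) r.1 * if h : r.2 < k then w r.2 h else 0)

lemma loopControl_eq (hP : IsStrictlyProper P) (τ : ℕ → Fin (c.maxDelay + 1)) (v : ℕ → ℝ) (k : ℕ) :
    loopControl c P K τ v k =
      ∑ q ∈ antidiagonal k, PowerSeries.coeff q.1 (impulseSeries K * impulseSeries P) *
        (v q.2 - ∑ r ∈ antidiagonal q.2, c.response (τ r.2) r.1 * loopControl c P K τ v r.2) := by
  rw [loopControl, WellFounded.fix_eq]
  refine Finset.sum_congr rfl fun q hq => ?_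
  -- The recursion reaches `r.2 = k` only when `q.1 = 0`, where the coefficient of `KP` vanishes;
  -- the default value `0` therefore has no effect.
  rcases Nat.eq_zero_or_pos q.1 with h0 | h0
  · have : PowerSeries.coeff 0 (impulseSeries K * impulseSeries P) = 0 := by
      simp [PowerSeries.coeff_mul, impulseResponse_zero_eq_zero hP]
    rw [h0, this, zero_mul, zero_mul]
  · congr 2
    refine Finset.sum_congr rfl fun r hr => ?_
    rw [mem_antidiagonal] at hq hr
    have : r.2 < k := by omega
    rw [dif_pos this]

/-- Mean-square stability speaks about given loop signals. Deducing anything from it requires that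
such signals exist. -/
lemma exists_isLoopResponse (hP : IsStrictlyProper P) (τ : ℕ → Fin (c.maxDelay + 1)) (v : ℕ → ℝ) :
    ∃ y u ud d : ℕ → ℝ, IsLoopResponse c P K τ v y u ud d := by
  set u := loopControl c P K τ v with hu
  set ud : ℕ → ℝ := fun k => ∑ q ∈ antidiagonal k, c.response (τ q.2) q.1 * u q.2 with hud
  refine ⟨fun k => ∑ q ∈ antidiagonal k, impulseResponse P q.1 * (v q.2 - ud q.2), u, ud, _,
    fun k => rfl, fun k => ?_, fun k => rfl, fun k => rfl⟩
  rw [hu, loopControl_eq hP]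
  have h := congrArg (PowerSeries.coeff k) (mul_assoc (impulseSeries K) (impulseSeries P)
    (PowerSeries.mk fun n => v n - ud n))
  rw [PowerSeries.coeff_mul, PowerSeries.coeff_mul] at h
  simp only [PowerSeries.coeff_mk, coeff_impulseSeries] at h
  refine h.trans (Finset.sum_congr rfl fun q _ => ?_)
  rw [PowerSeries.coeff_mul]
  simp

end Paths

/-! ### Second moments of the signals -/

section Moments
open Finset.HasAntidiagonal (antidiagonal mem_antidiagonal)

lemma IndepFun.prodMk_right {Ω α β γ : Type*} [MeasurableSpace Ω] [MeasurableSpace α]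
    [MeasurableSpace β] [MeasurableSpace γ] {μ : Measure Ω} [IsProbabilityMeasure μ]
    {X : Ω → α} {Y : Ω → β} {Z : Ω → γ} (hX : Measurable X) (hY : Measurable Y) (hZ : Measurable Z)
    (hXY : IndepFun X Y μ) (h : IndepFun (fun ω => (X ω, Y ω)) Z μ) :
    IndepFun X (fun ω => (Y ω, Z ω)) μ := by
  have := Measure.isProbabilityMeasure_map (μ := μ) hX.aemeasurable
  have := Measure.isProbabilityMeasure_map (μ := μ) hY.aemeasurable
  have := Measure.isProbabilityMeasure_map (μ := μ) hZ.aemeasurable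
  have hYZ : IndepFun Y Z μ := h.comp measurable_snd measurable_id
  rw [indepFun_iff_map_prod_eq_prod_map_map hX.aemeasurable (hY.prodMk hZ).aemeasurable,
    hYZ.map_prod_eq_prod_map_map hY.aemeasurable hZ.aemeasurable]
  have e : (fun ω => (X ω, Y ω, Z ω)) = MeasurableEquiv.prodAssoc ∘ fun ω => ((X ω, Y ω), Z ω) := rfl
  rw [e, ← Measure.map_map MeasurableEquiv.prodAssoc.measurable ((hX.prodMk hY).prodMk hZ),
    h.map_prod_eq_prod_map_map (hX.prodMk hY).aemeasurable hZ.aemeasurable,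
    hXY.map_prod_eq_prod_map_map hX.aemeasurable hY.aemeasurable]
  exact Measure.prodAssoc_prod ..

variable {Ω : Type} {c : Channel} {τ : ℕ → Ω → Fin (c.maxDelay + 1)} {v : ℕ → Ω → ℝ}

/-- The information on the input and on the delays of the data sent before time `n`. -/
abbrev past (τ : ℕ → Ω → Fin (c.maxDelay + 1)) (v : ℕ → Ω → ℝ) (n : ℕ) : MeasurableSpace Ω :=
  MeasurableSpace.comap (fun ω => ((fun i : Finset.range n => τ i ω), fun k => v k ω)) inferInstance

lemma measurable_past_iff {α : Type*} {m : MeasurableSpace α} {f : α → Ω} {n : ℕ} :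
    Measurable[m, past τ v n] f ↔
      (∀ i < n, Measurable fun a => τ i (f a)) ∧ ∀ k, Measurable fun a => v k (f a) := by
  rw [past, measurable_comap_iff]
  constructor
  · intro h
    exact ⟨fun i hi => (measurable_pi_apply (⟨i, Finset.mem_range.2 hi⟩ : Finset.range n)).comp
      h.fst, fun k => (measurable_pi_apply k).comp h.snd⟩
  · rintro ⟨h1, h2⟩
    exact Measurable.prodMk (measurable_pi_lambda _ fun i => h1 i (Finset.mem_range.1 i.2))
      (measurable_pi_lambda _ h2)

lemma measurable_past_delay {n i : ℕ} (hi : i < n) : Measurable[past τ v n] (τ i) :=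
  (measurable_past_iff.1 (@measurable_id Ω (past τ v n))).1 i hi

lemma measurable_past_input (n k : ℕ) : Measurable[past τ v n] (v k) :=
  (measurable_past_iff.1 (@measurable_id Ω (past τ v n))).2 k

lemma past_mono {m n : ℕ} (h : m ≤ n) : past τ v m ≤ past τ v n :=
  fun _ hs => (measurable_past_iff (f := id)).2
    ⟨fun _ hi => measurable_past_delay (hi.trans_le h), measurable_past_input n⟩ hs

variable [MeasurableSpace Ω] {μ : Measure Ω}

lemma past_le (hτ : ∀ n, Measurable (τ n)) (hv : ∀ k, Measurable (v k)) (n : ℕ) :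
    past τ v n ≤ ‹MeasurableSpace Ω› :=
  fun _ hs => (measurable_past_iff (f := id)).2 ⟨fun i _ => hτ i, hv⟩ hs

lemma IsDelayProcess.memLp_comp_mul (hτ : IsDelayProcess c μ τ) (n : ℕ) {U : Ω → ℝ} {p : ℝ≥0∞}
    (hU : MemLp U p μ) (f : Fin (c.maxDelay + 1) → ℝ) : MemLp (fun ω => f (τ n ω) * U ω) p μ := by
  refine hU.of_le_mul (c := ∑ j, |f j|) ?_ (Filter.Eventually.of_forall fun ω => ?_)
  · exact ((measurable_of_finite f).comp (hτ.measurable n)).aestronglyMeasurable.mul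
      hU.aestronglyMeasurable
  · rw [norm_mul]
    exact mul_le_mul_of_nonneg_right (Finset.single_le_sum (f := fun j => |f j|)
      (fun j _ => abs_nonneg _) (Finset.mem_univ (τ n ω))) (norm_nonneg _)

lemma IsWhiteNoise.integral_sq_filter (hv : IsWhiteNoise μ v) (g : ℕ → ℝ) (k : ℕ) :
    ∫ ω, (∑ q ∈ antidiagonal k, g q.1 * v q.2 ω) ^ 2 ∂μ =
      ∑ q ∈ antidiagonal k, g q.1 ^ 2 * ∫ ω, v q.2 ω ^ 2 ∂μ := by
  have hi : ∀ i j, Integrable (fun ω => v i ω * v j ω) μ := fun i j =>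
    (hv.memLp i).integrable_mul (hv.memLp j)
  have e : ∀ ω, (∑ q ∈ antidiagonal k, g q.1 * v q.2 ω) ^ 2 = ∑ q ∈ antidiagonal k,
      ∑ r ∈ antidiagonal k, g q.1 * g r.1 * (v q.2 ω * v r.2 ω) := fun ω => by
    simp_rw [sq, Finset.sum_mul_sum, mul_mul_mul_comm]
  simp_rw [e]
  rw [integral_finsetSum _ fun q _ => integrable_finsetSum _ fun r _ => (hi _ _).const_mul _]
  refine Finset.sum_congr rfl fun q hq => ?_
  rw [integral_finsetSum _ fun r _ => (hi _ _).const_mul _, Finset.sum_eq_single q]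
  · rw [integral_const_mul, ← sq]; simp_rw [← sq]
  · intro r hr hne
    rw [integral_const_mul, hv.uncorrelated, mul_zero]
    intro h
    apply hne
    rw [mem_antidiagonal] at hq hr
    ext <;> omega
  · exact fun h => absurd hq h

variable [IsProbabilityMeasure μ]

/-- The past contains the whole input, future values included. This is harmless because the input is
independent of all delays jointly. -/
lemma IsDelayProcess.indepFun_past (hτ : IsDelayProcess c μ τ) (hv : ∀ k, Measurable (v k))
    (hτv : IndepFun (fun ω n => τ n ω) (fun ω k => v k ω) μ) (n : ℕ) {Z : Ω → ℝ}
    (hZ : Measurable[past τ v n] Z) : IndepFun (τ n) Z μ := by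
  have h1 : IndepFun (τ n) (fun ω (i : Finset.range n) => τ i ω) μ :=
    (hτ.indep.indepFun_finset {n} (Finset.range n) (by simp) hτ.measurable).comp
      (φ := fun f : ({n} : Finset ℕ) → Fin (c.maxDelay + 1) => f ⟨n, Finset.mem_singleton_self n⟩)
      (measurable_pi_apply _) measurable_id
  have h2 : IndepFun (fun ω => (τ n ω, fun i : Finset.range n => τ i ω)) (fun ω k => v k ω) μ :=
    hτv.comp (φ := fun f : ℕ → Fin (c.maxDelay + 1) => (f n, fun i : Finset.range n => f i))
      (by fun_prop) measurable_id
  have h3 := IndepFun.prodMk_right (Y := fun ω (i : Finset.range n) => τ i ω) (hτ.measurable n)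
    (measurable_pi_lambda _ fun i => hτ.measurable i) (measurable_pi_lambda _ hv) h1 h2
  rw [IndepFun_iff_Indep] at h3 ⊢
  exact indep_of_indep_of_le_right h3 hZ.comap_le

lemma IsDelayProcess.integral_comp (hτ : IsDelayProcess c μ τ) (n : ℕ)
    (f : Fin (c.maxDelay + 1) → ℝ) : ∫ ω, f (τ n ω) ∂μ = ∑ j, c.prob j * f j := by
  have := Measure.isProbabilityMeasure_map (μ := μ) (hτ.measurable n).aemeasurable
  rw [← integral_map (hτ.measurable n).aemeasurable (f := f)
    (measurable_of_finite f).aestronglyMeasurable, integral_fintype .of_finite]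
  refine Finset.sum_congr rfl fun j _ => ?_
  rw [Measure.real, Measure.map_apply (hτ.measurable n) (measurableSet_singleton j)]
  have := hτ.law n j
  rw [show τ n ⁻¹' {j} = {ω | τ n ω = j} from rfl, this, ENNReal.toReal_ofReal (c.prob_nonneg j),
    smul_eq_mul]

lemma IsDelayProcess.integral_comp_mul (hτ : IsDelayProcess c μ τ) (hv : ∀ k, Measurable (v k))
    (hτv : IndepFun (fun ω n => τ n ω) (fun ω k => v k ω) μ) (n : ℕ) {Z : Ω → ℝ}
    (hZ : Measurable[past τ v n] Z) (f : Fin (c.maxDelay + 1) → ℝ) :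
    ∫ ω, f (τ n ω) * Z ω ∂μ = (∑ j, c.prob j * f j) * ∫ ω, Z ω ∂μ := by
  rw [← hτ.integral_comp n f]
  exact (hτ.indepFun_past hv hτv n hZ).integral_fun_comp_mul_comp (g := id)
    (hτ.measurable n).aemeasurable (hZ.mono (past_le hτ.measurable hv n) le_rfl).aemeasurable
    (measurable_of_finite f).aestronglyMeasurable measurable_id.aestronglyMeasurable

/-- The second moment increases by the mean energy of a new zero-mean term. -/
lemma IsDelayProcess.integral_sq_sub (hτ : IsDelayProcess c μ τ) (hv : ∀ k, Measurable (v k))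
    (hτv : IndepFun (fun ω n => τ n ω) (fun ω k => v k ω) μ) (n : ℕ) {S U : Ω → ℝ}
    (hS : Measurable[past τ v n] S) (hU : Measurable[past τ v n] U) (hS2 : MemLp S 2 μ)
    (hU2 : MemLp U 2 μ) {f : Fin (c.maxDelay + 1) → ℝ} (hf : ∑ j, c.prob j * f j = 0) :
    ∫ ω, (S ω - f (τ n ω) * U ω) ^ 2 ∂μ =
      ∫ ω, S ω ^ 2 ∂μ + (∑ j, c.prob j * f j ^ 2) * ∫ ω, U ω ^ 2 ∂μ := by
  have hSU : Integrable (fun ω => S ω * U ω) μ := hS2.integrable_mul hU2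
  have hUU : Integrable (fun ω => U ω ^ 2) μ := hU2.integrable_sq
  have i1 : Integrable (fun ω => 2 * f (τ n ω) * (S ω * U ω)) μ :=
    memLp_one_iff_integrable.1
      (hτ.memLp_comp_mul n (memLp_one_iff_integrable.2 hSU) fun j => 2 * f j)
  have i2 : Integrable (fun ω => f (τ n ω) ^ 2 * U ω ^ 2) μ :=
    memLp_one_iff_integrable.1
      (hτ.memLp_comp_mul n (memLp_one_iff_integrable.2 hUU) fun j => f j ^ 2)
  have e : ∀ ω, (S ω - f (τ n ω) * U ω) ^ 2 =
      S ω ^ 2 - 2 * f (τ n ω) * (S ω * U ω) + f (τ n ω) ^ 2 * U ω ^ 2 := fun ω => by ring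
  simp_rw [e]
  rw [integral_add (f := fun ω => S ω ^ 2 - 2 * f (τ n ω) * (S ω * U ω))
    (hS2.integrable_sq.sub i1) i2, integral_sub hS2.integrable_sq i1,
    hτ.integral_comp_mul hv hτv n (Z := fun ω => S ω * U ω) (hS.mul hU) fun j => 2 * f j,
    hτ.integral_comp_mul hv hτv n (Z := fun ω => U ω ^ 2) (hU.pow_const 2) fun j => f j ^ 2]
  have : ∑ j, c.prob j * (2 * f j) = 0 := by
    simp_rw [mul_left_comm _ (2 : ℝ), ← Finset.mul_sum, hf, mul_zero]
  rw [this]; ring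

/-- Induction peels off the latest datum: its term is a zero-mean function of `τ_N` times a variable
known before `τ_N`, so the cross term has zero expectation. -/
lemma IsDelayProcess.second_moment_sub_sum (hτ : IsDelayProcess c μ τ)
    (hv : ∀ k, Measurable (v k))
    (hτv : IndepFun (fun ω n => τ n ω) (fun ω k => v k ω) μ) {b : Ω → ℝ} {u : ℕ → Ω → ℝ}
    (hb : Measurable[past τ v 0] b) (hb2 : MemLp b 2 μ)
    {γ : ℕ → Fin (c.maxDelay + 1) → ℝ} (hγ : ∀ n, ∑ j, c.prob j * γ n j = 0) (N : ℕ)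
    (hu : ∀ n < N, Measurable[past τ v n] (u n) ∧ MemLp (u n) 2 μ) :
    Measurable[past τ v N] (fun ω => b ω - ∑ n ∈ Finset.range N, γ n (τ n ω) * u n ω) ∧
    MemLp (fun ω => b ω - ∑ n ∈ Finset.range N, γ n (τ n ω) * u n ω) 2 μ ∧
    ∫ ω, (b ω - ∑ n ∈ Finset.range N, γ n (τ n ω) * u n ω) ^ 2 ∂μ =
      ∫ ω, b ω ^ 2 ∂μ + ∑ n ∈ Finset.range N,
        (∑ j, c.prob j * γ n j ^ 2) * ∫ ω, u n ω ^ 2 ∂μ := by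
  induction N with
  | zero => simpa using ⟨hb, hb2⟩
  | succ N ih =>
    obtain ⟨h1, h2, h3⟩ := ih fun n hn => hu n (by omega)
    obtain ⟨hm, hL⟩ := hu N (by omega)
    have e : ∀ ω, b ω - ∑ n ∈ Finset.range (N + 1), γ n (τ n ω) * u n ω =
        (b ω - ∑ n ∈ Finset.range N, γ n (τ n ω) * u n ω) - γ N (τ N ω) * u N ω := fun ω => by
      rw [Finset.sum_range_succ]; ring
    simp_rw [e]
    refine ⟨?_, h2.sub (hτ.memLp_comp_mul N hL (γ N)), ?_⟩
    · refine (h1.mono (past_mono N.le_succ) le_rfl).sub (Measurable.mul ?_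
        (hm.mono (past_mono N.le_succ) le_rfl))
      exact (measurable_of_finite (γ N)).comp (measurable_past_delay N.lt_succ_self)
    · rw [hτ.integral_sq_sub hv hτv N h1 hm h2 hL (hγ N), h3, Finset.sum_range_succ]
      ring

lemma sum_antidiagonal_eq_sum_range (f : ℕ → ℕ → ℝ) (k : ℕ) :
    ∑ q ∈ antidiagonal k, f q.1 q.2 = ∑ n ∈ Finset.range (k + 1), f (k - n) n := by
  rw [← Finset.Nat.sum_antidiagonal_eq_sum_range_succ_mk (f := fun q => f q.2 q.1),
    ← Finset.Nat.sum_antidiagonal_swap]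
  rfl

variable {P K : RatFunc ℝ} {y u ud d : ℕ → Ω → ℝ}

/-- The second moments of the control signal satisfy a renewal equation. -/
lemma second_moment_control (hP : IsStrictlyProper P) (hK : IsProper K)
    (hτ : IsDelayProcess c μ τ) (hv : IsWhiteNoise μ v)
    (hτv : IndepFun (fun ω n => τ n ω) (fun ω k => v k ω) μ)
    (h : ∀ ω, IsLoopResponse c P K (fun n => τ n ω) (fun k => v k ω) (fun k => y k ω)
      (fun k => u k ω) (fun k => ud k ω) (fun k => d k ω)) (k : ℕ) :
    Measurable[past τ v k] (u k) ∧ MemLp (u k) 2 μ ∧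
    ∫ ω, u k ω ^ 2 ∂μ =
      ∑ q ∈ antidiagonal k, impulseResponse (nominal c P K) q.1 ^ 2 * ∫ ω, v q.2 ω ^ 2 ∂μ +
      ∑ n ∈ Finset.range k, c.gain (nominal c P K) (k - n) * ∫ ω, u n ω ^ 2 ∂μ := by
  -- Measurability and square integrability belong to the induction, since the orthogonality at time
  -- `k` uses them for all earlier `u n`.
  induction k using Nat.strong_induction_on with
  | _ k ih =>
  set G := nominal c P K with hG
  -- The term `n = k` drops out because the filtered deviation vanishes at lag `0`; only strictly
  -- earlier data remain.
  have e : ∀ ω, u k ω = (∑ q ∈ antidiagonal k, impulseResponse G q.1 * v q.2 ω) -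
      ∑ n ∈ Finset.range k, filteredDeviation c G (k - n) (τ n ω) * u n ω := fun ω => by
    rw [(h ω).control_eq hP hK k, ← hG,
      sum_antidiagonal_eq_sum_range fun l n => filteredDeviation c G l (τ n ω) * u n ω,
      Finset.sum_range_succ, Nat.sub_self,
      filteredDeviation_zero c (isStrictlyProper_nominal hP hK), zero_mul, add_zero]
  have hb : Measurable[past τ v 0]
      (fun ω => ∑ q ∈ antidiagonal k, impulseResponse G q.1 * v q.2 ω) :=
    Finset.measurable_fun_sum _ fun q _ => (measurable_past_input 0 q.2).const_mul _
  have hb2 : MemLp (fun ω => ∑ q ∈ antidiagonal k, impulseResponse G q.1 * v q.2 ω) 2 μ :=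
    memLp_finsetSum _ fun q _ => (hv.memLp q.2).const_mul _
  obtain ⟨h1, h2, h3⟩ := hτ.second_moment_sub_sum hv.measurable hτv hb hb2
    (γ := fun n => filteredDeviation c G (k - n))
    (fun n => sum_prob_mul_filteredDeviation c G (k - n)) k
    (fun n hn => ⟨(ih n hn).1, (ih n hn).2.1⟩)
  have hu : u k = fun ω => (∑ q ∈ antidiagonal k, impulseResponse G q.1 * v q.2 ω) -
      ∑ n ∈ Finset.range k, filteredDeviation c G (k - n) (τ n ω) * u n ω := funext e
  rw [← hu] at h1 h2
  refine ⟨h1, h2, ?_⟩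
  simp_rw [e]
  rw [h3, hv.integral_sq_filter]
  rfl

/-- The second moments of the output of the channel uncertainty. -/
lemma second_moment_uncertainty (hP : IsStrictlyProper P) (hK : IsProper K)
    (hτ : IsDelayProcess c μ τ) (hv : IsWhiteNoise μ v)
    (hτv : IndepFun (fun ω n => τ n ω) (fun ω k => v k ω) μ)
    (h : ∀ ω, IsLoopResponse c P K (fun n => τ n ω) (fun k => v k ω) (fun k => y k ω)
      (fun k => u k ω) (fun k => ud k ω) (fun k => d k ω)) (k : ℕ) :
    MemLp (d k) 2 μ ∧
    ∫ ω, d k ω ^ 2 ∂μ = ∑ n ∈ Finset.range (k + 1),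
      (∑ j, c.prob j * c.deviation j (k - n) ^ 2) * ∫ ω, u n ω ^ 2 ∂μ := by
  have hu := second_moment_control hP hK hτ hv hτv h
  -- No filter `G` intervenes here, so the datum sent at time `k` itself contributes. The double
  -- sign fits the form `b - ∑` with `b = 0`.
  have e : d k = fun ω => -(0 - ∑ n ∈ Finset.range (k + 1),
      c.deviation (τ n ω) (k - n) * u n ω) := funext fun ω => by
    rw [(h ω).uncertainty k,
      sum_antidiagonal_eq_sum_range fun l n => c.deviation (τ n ω) l * u n ω, zero_sub, neg_neg]
  obtain ⟨-, h2, h3⟩ := hτ.second_moment_sub_sum hv.measurable hτv (b := fun _ => 0) (u := u)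
    measurable_const (MemLp.zero (p := 2) (μ := μ)) (γ := fun n j => c.deviation j (k - n))
    (fun n => c.sum_prob_mul_deviation (k - n)) (k + 1) (fun n _ => ⟨(hu n).1, (hu n).2.1⟩)
  rw [e]
  refine ⟨h2.neg, ?_⟩
  simp_rw [neg_sq]
  rw [h3]
  simp

end Moments

/-! ### Renewal inequalities -/

section Renewal
open Filter Topology

lemma sum_comp_le_of_hasSum {σ : ℕ → ℝ} {s : ℝ} (hσ : ∀ l, 0 ≤ σ l) (hs : HasSum σ s)
    (t : Finset ℕ) {f : ℕ → ℕ} (hf : Set.InjOn f t) : ∑ n ∈ t, σ (f n) ≤ s := by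
  rw [← Finset.sum_image (f := σ) hf]
  exact sum_le_hasSum _ (fun i _ => hσ i) hs

/-- The bound is the fixed point of `B = C + sB`, hence is inherited along the recursion. -/
lemma bounded_of_renewal {σ x : ℕ → ℝ} {s C : ℝ} (hσ : ∀ l, 0 ≤ σ l) (hs : HasSum σ s)
    (hs1 : s < 1) (hC : 0 ≤ C)
    (h : ∀ k, x k ≤ C + ∑ n ∈ Finset.range k, σ (k - n) * x n) (k : ℕ) : x k ≤ C / (1 - s) := by
  have hB : 0 ≤ C / (1 - s) := div_nonneg hC (by linarith)
  induction k using Nat.strong_induction_on with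
  | _ k ih =>
  calc x k ≤ C + ∑ n ∈ Finset.range k, σ (k - n) * x n := h k
    _ ≤ C + ∑ n ∈ Finset.range k, σ (k - n) * (C / (1 - s)) := by
        gcongr with n hn
        · exact hσ _
        · exact ih n (Finset.mem_range.1 hn)
    _ ≤ C + s * (C / (1 - s)) := by
        rw [← Finset.sum_mul]
        gcongr
        refine sum_comp_le_of_hasSum hσ hs _ fun a ha b hb hab => ?_
        simp only [Finset.coe_range, Set.mem_Iio] at ha hb hab
        omega
    _ = C / (1 - s) := by
        have : 1 - s ≠ 0 := by linarith
        field_simp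
        ring

/-- If `s ≥ 1`, the constant source `a` is never dissipated. The solution eventually exceeds `j * (a
/ 2)` for every `j`, contradicting boundedness. -/
lemma lt_one_of_renewal {σ x : ℕ → ℝ} {s C a : ℝ} {k₀ : ℕ} (hσ : ∀ l, 0 ≤ σ l) (hσ0 : σ 0 = 0)
    (hs : HasSum σ s) (ha : 0 < a) (hx0 : ∀ k, 0 ≤ x k) (hxC : ∀ k, x k ≤ C)
    (h : ∀ k ≥ k₀, a + ∑ n ∈ Finset.range k, σ (k - n) * x n ≤ x k) : s < 1 := by
  by_contra! hs1
  have hs' : HasSum (fun l => σ (l + 1)) s := by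
    simpa [hσ0] using (hasSum_nat_add_iff' 1).2 hs
  have key : ∀ j : ℕ, ∃ N, ∀ k ≥ N, j * (a / 2) ≤ x k := by
    intro j
    induction j with
    | zero => exact ⟨0, fun k _ => by simpa using hx0 k⟩
    | succ j ih =>
      obtain ⟨N, hN⟩ := ih
      -- A partial sum of `σ` above `1 - 1/(j+1)` turns the eventual bound `j·a/2` into at least `a
      -- + j·a/2 - a/2 = (j+1)·a/2`.
      have hδ : 1 - 1 / ((j : ℝ) + 1) < s := by
        have : 0 < 1 / ((j : ℝ) + 1) := by positivity
        linarith
      obtain ⟨m, hm⟩ := (hs'.tendsto_sum_nat.eventually (lt_mem_nhds hδ)).exists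
      refine ⟨max k₀ (N + m), fun k hk => ?_⟩
      have hk0 : k₀ ≤ k := le_trans (le_max_left _ _) hk
      have hkm : N + m ≤ k := le_trans (le_max_right _ _) hk
      have h1 : ∑ l ∈ Finset.range m, σ (l + 1) * (j * (a / 2)) ≤
          ∑ n ∈ Finset.range k, σ (k - n) * x n := by
        rw [← Finset.sum_range_reflect (fun n => σ (k - n) * x n) k]
        refine (Finset.sum_le_sum fun l hl => ?_).trans
          (Finset.sum_le_sum_of_subset_of_nonneg (Finset.range_mono (show m ≤ k by omega))
            fun _ _ _ => mul_nonneg (hσ _) (hx0 _))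
        rw [Finset.mem_range] at hl
        rw [show k - (k - 1 - l) = l + 1 by omega]
        exact mul_le_mul_of_nonneg_left (hN _ (by omega)) (hσ _)
      rw [← Finset.sum_mul] at h1
      have h2 := h k hk0
      have h3 : (1 - 1 / ((j : ℝ) + 1)) * (j * (a / 2)) ≤
          (∑ l ∈ Finset.range m, σ (l + 1)) * (j * (a / 2)) :=
        mul_le_mul_of_nonneg_right hm.le (by positivity)
      have h4 : (1 / ((j : ℝ) + 1)) * (j * (a / 2)) ≤ a / 2 := by
        rw [← mul_assoc]
        refine mul_le_of_le_one_left (by positivity) ?_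
        rw [one_div, inv_mul_le_iff₀ (by positivity)]
        linarith
      push_cast
      linarith
  obtain ⟨j, hj⟩ := exists_nat_gt (C / (a / 2))
  obtain ⟨N, hN⟩ := key j
  rw [div_lt_iff₀ (by positivity)] at hj
  linarith [hN N le_rfl, hxC N]

end Renewal

/-! ### Mean-square input-output stability -/

section Stability
open Finset.HasAntidiagonal (antidiagonal mem_antidiagonal)

variable {c : Channel} {P K : RatFunc ℝ}

lemma lintegral_ofReal_sq_eq {Ω : Type*} [MeasurableSpace Ω] {μ : Measure Ω} {f : Ω → ℝ}
    (hf : MemLp f 2 μ) :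
    ∫⁻ ω, ENNReal.ofReal (f ω ^ 2) ∂μ = ENNReal.ofReal (∫ ω, f ω ^ 2 ∂μ) :=
  (ofReal_integral_eq_lintegral_ofReal hf.integrable_sq
    (Filter.Eventually.of_forall fun _ => sq_nonneg _)).symm

lemma sum_prob_mul_sq_nonneg (c : Channel) (f : Fin (c.maxDelay + 1) → ℝ) :
    0 ≤ ∑ j, c.prob j * f j ^ 2 :=
  Finset.sum_nonneg fun j _ => mul_nonneg (c.prob_nonneg j) (sq_nonneg _)

lemma summable_deviation_energy (c : Channel) :
    Summable fun l => ∑ j, c.prob j * c.deviation j l ^ 2 := by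
  refine summable_of_ne_finset_zero (s := Finset.range (c.maxDelay + 1)) fun l hl => ?_
  rw [Finset.mem_range, not_lt] at hl
  simp [c.deviation_eq_zero _ (Nat.lt_of_succ_le hl)]

lemma isMeanSquareIOStable_of_gain_lt_one (hP : IsStrictlyProper P) (hK : IsProper K)
    (hG : IsStable (nominal c P K)) {s : ℝ} (hs : HasSum (c.gain (nominal c P K)) s)
    (hs1 : s < 1) : IsMeanSquareIOStable c P K := by
  refine ⟨hG, ?_⟩
  intro Ω _ μ _ τ v y u ud d hτ hv hτv h
  have hu := second_moment_control hP hK hτ hv hτv h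
  have hd := second_moment_uncertainty hP hK hτ hv hτv h
  obtain ⟨Cv, hCv⟩ := hv.bounded_variance
  have hCv0 : 0 ≤ Cv := (integral_nonneg fun ω => sq_nonneg (v 0 ω)).trans (hCv 0)
  have hg := hasSum_sq_impulseResponse (nominal_mem_rhinf hP hK hG)
  set E := (2 * Real.pi)⁻¹ * ∫ θ in (-Real.pi)..Real.pi,
    ‖evalAt (Complex.exp (θ * Complex.I)) (nominal c P K)‖ ^ 2 with hE
  have hE0 : 0 ≤ E := hg.nonneg fun _ => sq_nonneg _
  have hb : ∀ k, ∑ q ∈ antidiagonal k, impulseResponse (nominal c P K) q.1 ^ 2 *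
      ∫ ω, v q.2 ω ^ 2 ∂μ ≤ E * Cv := fun k => by
    refine (Finset.sum_le_sum fun q _ =>
      mul_le_mul_of_nonneg_left (hCv q.2) (sq_nonneg _)).trans ?_
    rw [← Finset.sum_mul,
      sum_antidiagonal_eq_sum_range (fun l _ => impulseResponse (nominal c P K) l ^ 2) k]
    refine mul_le_mul_of_nonneg_right ?_ hCv0
    refine sum_comp_le_of_hasSum (fun _ => sq_nonneg _) hg _ fun a ha b hb hab => ?_
    simp only [Finset.coe_range, Set.mem_Iio] at ha hb hab
    omega
  set B := E * Cv / (1 - s) with hB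
  have hB0 : 0 ≤ B := div_nonneg (by positivity) (by linarith)
  have hxB : ∀ k, ∫ ω, u k ω ^ 2 ∂μ ≤ B :=
    bounded_of_renewal (c.gain_nonneg _) hs hs1 (by positivity) fun k => by
      rw [(hu k).2.2]; linarith [hb k]
  have hD := summable_deviation_energy c
  set D := ∑' l, ∑ j, c.prob j * c.deviation j l ^ 2
  have hdB : ∀ k, ∫ ω, d k ω ^ 2 ∂μ ≤ D * B := fun k => by
    rw [(hd k).2]
    refine (Finset.sum_le_sum fun n _ =>
      mul_le_mul_of_nonneg_left (hxB n) (sum_prob_mul_sq_nonneg c _)).trans ?_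
    rw [← Finset.sum_mul]
    refine mul_le_mul_of_nonneg_right ?_ hB0
    refine sum_comp_le_of_hasSum (f := fun n => k - n)
      (fun l => sum_prob_mul_sq_nonneg c fun j => c.deviation j l) hD.hasSum _
      fun a ha b hb hab => ?_
    simp only [Finset.coe_range, Set.mem_Iio] at ha hb hab
    omega
  refine ⟨(max B (D * B)).toNNReal, fun k => ⟨?_, ?_⟩⟩
  · rw [lintegral_ofReal_sq_eq (hu k).2.1]
    exact ENNReal.ofReal_le_ofReal ((hxB k).trans (le_max_left _ _))
  · rw [lintegral_ofReal_sq_eq (hd k).1]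
    exact ENNReal.ofReal_le_ofReal ((hdB k).trans (le_max_right _ _))

/-- The law of the delay. -/
noncomputable def delayLaw (c : Channel) : Measure (Fin (c.maxDelay + 1)) :=
  ∑ j, ENNReal.ofReal (c.prob j) • Measure.dirac j

lemma delayLaw_singleton (c : Channel) (i : Fin (c.maxDelay + 1)) :
    delayLaw c {i} = ENNReal.ofReal (c.prob i) := by
  rw [delayLaw, Measure.finsetSum_apply, Finset.sum_eq_single i]
  · simp
  · intro j _ hj
    simp [hj]
  · simp

instance (c : Channel) : IsProbabilityMeasure (delayLaw c) := by
  constructor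
  rw [delayLaw, Measure.finsetSum_apply]
  simp [← ENNReal.ofReal_sum_of_nonneg fun j _ => c.prob_nonneg j, c.prob_sum]

/-- There are delays with the law of the channel and an independent white noise of unit variance. -/
lemma exists_delayProcess_whiteNoise (c : Channel) :
    ∃ (Ω : Type) (_ : MeasurableSpace Ω) (μ : Measure Ω) (_ : IsProbabilityMeasure μ)
      (τ : ℕ → Ω → Fin (c.maxDelay + 1)) (v : ℕ → Ω → ℝ), IsDelayProcess c μ τ ∧
      IsWhiteNoise μ v ∧ IndepFun (fun ω n => τ n ω) (fun ω k => v k ω) μ ∧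
      ∀ k, ∫ ω, v k ω ^ 2 ∂μ = 1 := by
  let μ₁ : Measure (ℕ → Fin (c.maxDelay + 1)) := Measure.infinitePi fun _ => delayLaw c
  let μ₂ : Measure (ℕ → ℝ) := Measure.infinitePi fun _ => gaussianReal 0 1
  have hev : ∀ k, MeasurePreserving (fun ω : (ℕ → Fin (c.maxDelay + 1)) × (ℕ → ℝ) => ω.2 k)
      (μ₁.prod μ₂) (gaussianReal 0 1) := fun k =>
    (measurePreserving_eval_infinitePi (fun _ => gaussianReal 0 1) k).comp measurePreserving_snd
  have hdel : ∀ n, MeasurePreserving (fun ω : (ℕ → Fin (c.maxDelay + 1)) × (ℕ → ℝ) => ω.1 n)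
      (μ₁.prod μ₂) (delayLaw c) := fun n =>
    (measurePreserving_eval_infinitePi (fun _ => delayLaw c) n).comp measurePreserving_fst
  have hint : ∀ k (f : ℝ → ℝ), Measurable f →
      ∫ ω, f (ω.2 k) ∂(μ₁.prod μ₂) = ∫ x, f x ∂(gaussianReal 0 1) := fun k f hf => by
    rw [← (hev k).map_eq, integral_map (hev k).measurable.aemeasurable hf.aestronglyMeasurable]
  have hmean : ∀ k, ∫ ω, ω.2 k ∂(μ₁.prod μ₂) = 0 := fun k => by
    rw [hint k (fun x => x) measurable_id, integral_id_gaussianReal]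
  have hvar : ∀ k, ∫ ω, ω.2 k ^ 2 ∂(μ₁.prod μ₂) = 1 := fun k => by
    rw [hint k (fun x => x ^ 2) (by fun_prop)]
    have h := variance_of_integral_eq_zero (μ := gaussianReal 0 1) (X := id)
      aemeasurable_id (by simp)
    rw [variance_id_gaussianReal] at h
    simpa using h.symm
  have hv : iIndepFun (fun k (ω : (ℕ → Fin (c.maxDelay + 1)) × (ℕ → ℝ)) => ω.2 k)
      (μ₁.prod μ₂) := by
    rw [iIndepFun_iff_map_fun_eq_infinitePi_map fun k => by fun_prop]
    simp_rw [fun k => (hev k).map_eq]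
    exact Measure.snd_prod
  have hτ : iIndepFun (fun n (ω : (ℕ → Fin (c.maxDelay + 1)) × (ℕ → ℝ)) => ω.1 n)
      (μ₁.prod μ₂) := by
    rw [iIndepFun_iff_map_fun_eq_infinitePi_map fun k => by fun_prop]
    simp_rw [fun n => (hdel n).map_eq]
    exact Measure.fst_prod
  refine ⟨_, _, μ₁.prod μ₂, inferInstance, fun n ω => ω.1 n, fun k ω => ω.2 k,
    ⟨fun n => by fun_prop, hτ, fun n i => ?_⟩, ⟨fun k => by fun_prop, fun k => ?_, hmean, ?_, 1,
      fun k => (hvar k).le⟩, indepFun_prod measurable_id measurable_id, hvar⟩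
  · rw [← delayLaw_singleton, ← (hdel n).measure_preimage
      (measurableSet_singleton i).nullMeasurableSet]
    rfl
  · exact (memLp_id_gaussianReal 2).comp_measurePreserving (hev k)
  · intro j k hjk
    rw [(hv.indepFun hjk).integral_fun_mul_eq_mul_integral
      (hev j).measurable.aestronglyMeasurable (hev k).measurable.aestronglyMeasurable,
      hmean, zero_mul]

/-- Test with white noise of unit variance. If `g(n₀) ≠ 0`, the input adds at least `g(n₀)²` to
every second moment from time `n₀` on, the source in `lt_one_of_renewal`. If `g = 0`, the gain
vanishes. -/
lemma gain_lt_one_of_isMeanSquareIOStable (hP : IsStrictlyProper P) (hK : IsProper K)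
    (h : IsMeanSquareIOStable c P K) {s : ℝ} (hs : HasSum (c.gain (nominal c P K)) s) : s < 1 := by
  by_cases hG0 : ∀ n, impulseResponse (nominal c P K) n = 0
  · have h0 : impulseSeries (nominal c P K) = 0 := by ext n; simp [hG0 n]
    have h1 : c.gain (nominal c P K) = fun _ => 0 := by ext l; simp [Channel.gain, h0]
    rw [h1] at hs
    rw [hs.unique hasSum_zero]
    exact zero_lt_one
  push Not at hG0
  obtain ⟨n₀, hn₀⟩ := hG0
  obtain ⟨Ω, _, μ, _, τ, v, hτ, hv, hτv, hvar⟩ := exists_delayProcess_whiteNoise c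
  choose y u ud d hloop using fun ω => exists_isLoopResponse (c := c) (K := K) hP
    (fun n => τ n ω) (fun k => v k ω)
  obtain ⟨C, hC⟩ := h.2 Ω μ τ v (fun k ω => y ω k) (fun k ω => u ω k) (fun k ω => ud ω k)
    (fun k ω => d ω k) hτ hv hτv hloop
  have hu := second_moment_control (y := fun k ω => y ω k) (u := fun k ω => u ω k)
    (ud := fun k ω => ud ω k) (d := fun k ω => d ω k) hP hK hτ hv hτv hloop
  refine lt_one_of_renewal (σ := c.gain (nominal c P K)) (x := fun k => ∫ ω, u ω k ^ 2 ∂μ) (C := C)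
    (a := impulseResponse (nominal c P K) n₀ ^ 2) (k₀ := n₀) (c.gain_nonneg _) ?_ hs (by positivity)
    (fun k => integral_nonneg fun ω => sq_nonneg _) (fun k => ?_) fun k hk => ?_
  · have h0 : ∀ j, PowerSeries.coeff 0 (impulseSeries (nominal c P K) * (c.deviationPoly j : PowerSeries ℝ)) = 0 :=
      filteredDeviation_zero c (isStrictlyProper_nominal hP hK)
    simp only [Channel.gain, h0]
    simp
  · have h1 := (lintegral_ofReal_sq_eq (hu k).2.1).symm.trans_le (hC k).1
    rw [← ENNReal.ofReal_coe_nnreal] at h1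
    exact (ENNReal.ofReal_le_ofReal_iff C.2).1 h1
  · rw [(hu k).2.2]
    gcongr
    simp_rw [hvar, mul_one]
    have key : ∀ f : ℕ → ℝ, f n₀ ^ 2 ≤ ∑ q ∈ antidiagonal k, f q.1 ^ 2 := fun f =>
      Finset.single_le_sum (f := fun q : ℕ × ℕ => f q.1 ^ 2) (a := (n₀, k - n₀))
        (fun q _ => sq_nonneg _) (mem_antidiagonal.2 (Nat.add_sub_cancel' hk))
    exact key _

end Stability

/-! ### Internally stabilizing controllers -/

section Youla

variable {L N M Nt Mt U V Ut Vt : RatFunc ℝ}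

lemma IsDoublyCoprime.identities (h : IsDoublyCoprime L N M Nt Mt U V Ut Vt) :
    Vt * M + Ut * N = 1 ∧ Nt * U + Mt * V = 1 ∧ N = L * M ∧ Nt = Mt * L := by
  have e1 := congrFun (congrFun h.bezout 0) 0
  have e2 := congrFun (congrFun h.bezout 1) 1
  simp [Matrix.mul_apply, Fin.sum_univ_two] at e1 e2
  refine ⟨e1, e2, ?_, ?_⟩
  · rw [h.right_fac, mul_assoc, inv_mul_cancel₀ h.M_ne_zero, mul_one]
  · rw [h.left_fac, ← mul_assoc, mul_inv_cancel₀ h.Mt_ne_zero, one_mul]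

/-- Every stabilizing controller is given by a Youla parameter. -/
lemma IsDoublyCoprime.exists_youla (h : IsDoublyCoprime L N M Nt Mt U V Ut Vt) {K : RatFunc ℝ}
    (hK : InternallyStabilizes K L) :
    ∃ Q ∈ RHinf, (U + M * Q) * Nt = L * K / (1 + L * K) := by
  obtain ⟨h0, hE, hKE, hLE, hLKE⟩ := hK
  obtain ⟨b1, b2, hN, hNt⟩ := h.identities
  -- Solving `K = (U + MQ)/(V - NQ)` gives `Q = (VK - U)/(M + NK)`. With `M⁻¹ = Vt + Ut L`, from the
  -- Bezout identity, this expands into the four stable closed-loop functions.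
  refine ⟨V * Vt * (K / (1 + L * K)) + V * Ut * (L * K / (1 + L * K)) -
    U * Vt * (1 / (1 + L * K)) - U * Ut * (L / (1 + L * K)), ?_, ?_⟩
  · rw [← mem_rhinf] at *
    have hU := mem_rhinf.2 h.U_mem
    have hV := mem_rhinf.2 h.V_mem
    have hUt := mem_rhinf.2 h.Ut_mem
    have hVt := mem_rhinf.2 h.Vt_mem
    exact sub_mem (sub_mem (add_mem (mul_mem (mul_mem hV hVt) hKE) (mul_mem (mul_mem hV hUt) hLKE))
      (mul_mem (mul_mem hU hVt) hE)) (mul_mem (mul_mem hU hUt) hLE)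
  · subst hN hNt
    have e := mul_inv_cancel₀ h0
    simp only [div_eq_mul_inv, one_mul]
    generalize (1 + L * K)⁻¹ = E at e
    linear_combination ((K * V - U) * E * Mt * L) * b1 + L * K * E * b2 - U * Mt * L * e

/-- The controller of a Youla parameter stabilizes a strictly proper plant. -/
lemma IsDoublyCoprime.stabilizes_of_youla (h : IsDoublyCoprime L N M Nt Mt U V Ut Vt)
    (hL : inftyVal L < 1) {Q : RatFunc ℝ} (hQ : Q ∈ RHinf) :
    ∃ K, IsProper K ∧ InternallyStabilizes K L ∧
      (U + M * Q) * Nt = L * K / (1 + L * K) := by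
  obtain ⟨b1, b2, hN, hNt⟩ := h.identities
  rw [← mem_rhinf] at hQ
  have hU := mem_rhinf.2 h.U_mem
  have hV := mem_rhinf.2 h.V_mem
  have hM := mem_rhinf.2 h.M_mem
  have hNm := mem_rhinf.2 h.N_mem
  have hMt := mem_rhinf.2 h.Mt_mem
  have hNtm := mem_rhinf.2 h.Nt_mem
  have val : ∀ {F}, F ∈ rhinf → inftyVal F ≤ 1 := fun hF => isProper_iff_inftyVal_le_one.1 hF.1
  have hA : U + M * Q ∈ rhinf := add_mem hU (mul_mem hM hQ)
  have hB : V - N * Q ∈ rhinf := sub_mem hV (mul_mem hNm hQ)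
  have hMtB : Mt * (V - N * Q) + Nt * (U + M * Q) = 1 := by
    subst hN hNt; linear_combination b2
  generalize V - N * Q = B at hB hMtB
  generalize U + M * Q = A at hA hMtB ⊢
  have hvNt : inftyVal (Nt * A) < 1 := by
    rw [hNt, mul_comm Mt, mul_assoc, map_mul]
    exact mul_lt_one_of_lt_of_le hL (val (mul_mem hMt hA))
  -- In `Mt B + Nt A = 1` the second term is strictly proper, so `Mt B` has valuation `1`. Both
  -- factors have valuation at most `1`, so `B⁻¹` is proper and so is `K = A / B`.
  have hvB : inftyVal B = 1 := by
    have h1 : inftyVal (Mt * B) = 1 := by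
      rw [eq_sub_of_add_eq hMtB, sub_eq_add_neg]
      exact inftyVal_one_add (by rwa [Valuation.map_neg])
    refine le_antisymm (val hB) ?_
    rw [← h1, map_mul]
    exact mul_le_of_le_one_left' (val hMt)
  have hB0 : B ≠ 0 := by
    intro h0; rw [h0, map_zero] at hvB; exact zero_ne_one hvB
  have hMt0 := h.Mt_ne_zero
  have hL' : L = Nt / Mt := by rw [hNt]; field_simp
  -- Hence the four closed-loop functions are `Mt B`, `A Mt`, `Nt B` and `A Nt`, all stable.
  have e : 1 + L * (A / B) = 1 / (Mt * B) := by
    rw [hL']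
    field_simp
    linear_combination hMtB
  refine ⟨A / B, ?_, ⟨?_, ?_, ?_, ?_, ?_⟩, ?_⟩
  · rw [isProper_iff_inftyVal_le_one, map_div₀, hvB, div_one]
    exact val hA
  · rw [e]; exact one_div_ne_zero (mul_ne_zero hMt0 hB0)
  · rw [e, one_div_one_div]; exact mul_mem hMt hB
  · have : A / B / (1 / (Mt * B)) = A * Mt := by field_simp
    rw [e, this]; exact mul_mem hA hMt
  · have : L / (1 / (Mt * B)) = Nt * B := by rw [hL']; field_simp
    rw [e, this]; exact mul_mem hNtm hB
  · have : L * (A / B) / (1 / (Mt * B)) = A * Nt := by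
      rw [hL']; field_simp
    rw [e, this]; exact mul_mem hA hNtm
  · rw [e, hL']; field_simp

end Youla

/-- The link between the Youla parametrization of the loop with `PH` and the nominal system: the
complementary sensitivity is `GH`. -/
lemma nominal_mul_meanTF {c : Channel} (P K : RatFunc ℝ) :
    nominal c P K * c.meanTF = P * c.meanTF * K / (1 + P * c.meanTF * K) := by
  rw [nominal, mul_right_comm P c.meanTF K]
  ring

/-- The nominal system is stable if its mean-channel response and its response filtered by the
spectral factor are. -/
lemma isStable_of_mul_mem {c : Channel} {Φ G : RatFunc ℝ} (hΦ : c.IsSpectralFactor Φ)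
    (hH : c.meanTF ≠ 0) (h1 : G * c.meanTF ∈ rhinf) (h2 : G * Φ ∈ rhinf) : IsStable G := by
  intro z hz
  have key : ∀ F : RatFunc ℝ, evalAt z F ≠ 0 → G * F ∈ rhinf → G ∈ regularAt z := fun F hF hGF => by
    have hF0 : F ≠ 0 := by rintro rfl; simp at hF
    have := mul_mem (mem_regularAt_of_mem_rhinf hGF hz) (inv_mem_regularAt hF)
    rwa [mul_assoc, mul_inv_cancel₀ hF0, mul_one] at this
  by_cases hz0 : evalAt z c.meanTF = 0
  · exact key Φ (hΦ.evalAt_ne_zero hH hz hz0) h2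
  · exact key _ hz0 h1

end DelayNCS

theorem mainTheorem5 (c : DelayNCS.Channel) (P : RatFunc ℝ) (hP : DelayNCS.IsStrictlyProper P)
    (hH : c.meanTF ≠ 0) (Φ : RatFunc ℝ) (hΦ : c.IsSpectralFactor Φ)
    (N M Nt Mt U V Ut Vt : RatFunc ℝ)
    (hF : DelayNCS.IsDoublyCoprime (P * c.meanTF) N M Nt Mt U V Ut Vt)
    (W : RatFunc ℝ) (hW : W = Φ / c.meanTF) :
    DelayNCS.IsMeanSquareStabilizable c P ↔
      (⨅ Q ∈ DelayNCS.RHinf, DelayNCS.h2NormSq ((U + M * Q) * Nt * W)) < 1 := by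
  open DelayNCS in
  have hGΦ : ∀ K Q, (U + M * Q) * Nt = P * c.meanTF * K / (1 + P * c.meanTF * K) →
      (U + M * Q) * Nt * W = nominal c P K * Φ := fun K Q h => by
    rw [h, ← nominal_mul_meanTF, hW, mul_assoc, mul_div_cancel₀ _ hH]
  simp only [iInf_lt_iff]
  constructor
  · rintro ⟨K, hK, hstab, hms⟩
    obtain ⟨Q, hQ, hQK⟩ := hF.exists_youla hstab
    obtain ⟨s, hs, hnorm⟩ := hΦ.exists_hasSum_gain (nominal_mem_rhinf hP hK hms.1)
    refine ⟨Q, hQ, ?_⟩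
    rw [hGΦ K Q hQK, hnorm, ENNReal.ofReal_lt_one]
    exact gain_lt_one_of_isMeanSquareIOStable hP hK hms hs
  · rintro ⟨Q, hQ, hlt⟩
    have hL : inftyVal (P * c.meanTF) < 1 := by
      rw [map_mul]
      exact mul_lt_one_of_lt_of_le (isStrictlyProper_iff_inftyVal_lt_one.1 hP)
        (isProper_iff_inftyVal_le_one.1 c.meanTF_mem_rhinf.1)
    obtain ⟨K, hK, hstab, hQK⟩ := hF.stabilizes_of_youla hL hQ
    rw [hGΦ K Q hQK] at hlt
    -- The convention that the norm is `∞` off `RHinf` enters here: a finite norm supplies the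
    -- stability of `GΦ`.
    have hmem : nominal c P K * Φ ∈ rhinf := by
      by_contra hc
      rw [h2NormSq, if_neg (mem_rhinf.not.1 hc)] at hlt
      exact not_top_lt hlt
    have hG : IsStable (nominal c P K) :=
      isStable_of_mul_mem hΦ hH (by rw [nominal_mul_meanTF]; exact hstab.2.2.2.2) hmem
    obtain ⟨s, hs, hnorm⟩ := hΦ.exists_hasSum_gain (nominal_mem_rhinf hP hK hG)
    rw [hnorm, ENNReal.ofReal_lt_one] at hlt
    exact ⟨K, hK, hstab, isMeanSquareIOStable_of_gain_lt_one hP hK hG hs hlt⟩
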